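/- Let $(\Omega,\mathcal F,P)$ be a probability space with a filtration $\mathbb F=\{\mathcal F_t,\ t\in[0,1]\}$ which is left-continuous at $1$, i.e. $\sigma\big(\bigcup_{t<1}\mathcal F_t\big)=\mathcal F_1$, and let $X=\{X(t),\ t\in[0,1]\}$ be a real-valued $\mathbb F$-adapted process. Let $\tfrac12<a\le\alpha$ and assume: 1. (Hölder continuity) for almost every $\omega$ there is a finite $C=C(\omega)$ such that $|X(t)-X(s)|\le C|t-s|^{a}$ for all $s,t\in[0,1]$; 2. (small ball estimate) there are constants $\delta>0$ and $C>0$ such that for all $s\le t$ in $[1-\delta,1]\cap[0,1]$, with $\Delta=t-s$, and all $0<\epsilon\le\Delta^{\alpha}$, $$P\Big(\sup_{s\le u\le t}|X(u)-X(s)|\le\epsilon\Big)\le\exp\big(-C\Delta\epsilon^{-1/\alpha}\big).$$ For $\beta\in(0,1)$ and functions $f,g$ on $[0,t]$, put $g_{t-}=g-g(t)$ and $$D_{0+}^{\beta}f(x)=\frac1{\Gamma(1-\beta)}\Big(\frac{f(x)}{x^\beta}+\beta\int_0^x\frac{f(x)-f(u)}{(x-u)^{\beta+1}}\,du\Big),$$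 $$D_{t-}^{1-\beta}g(x)=\frac1{\Gamma(\beta)}\Big(\frac{g(x)}{(t-x)^{1-\beta}}+(1-\beta)\int_x^t\frac{g(x)-g(u)}{(u-x)^{2-\beta}}\,du\Big).$$ The generalized Lebesgue--Stieltjes integral of order $\beta$ is $$\int_0^t f\,dg=-\int_0^t \big(D_{0+}^{\beta}f\big)(x)\,\big(D_{t-}^{1-\beta}g_{t-}\big)(x)\,dx ,$$ and we say that it exists if $f$ is measurable and $$\int_0^t\Big(\frac{|f(r)|}{r^\beta}+\int_0^r\frac{|f(r)-f(s)|}{(r-s)^{\beta+1}}\,ds\Big)dr<\infty,\qquad \sup_{0\le u<v\le t}\Big(\frac{|g(v)-g(u)|}{(v-u)^{1-\beta}}+\int_u^v\frac{|g(u)-g(z)|}{(z-u)^{2-\beta}}\,dz\Big)<\infty .$$ Then for every real-valued $\mathcal F_1$-measurable random variable $\xi$ there are a constant $\beta\in(1-a,1)$ and an $\mathbb F$-adapted process $\psi$ such that, almost surely, the generalized Lebesgue--Stieltjes integral $\int_0^t\psi(s)\,dX(s)$ of order $\beta$ exists for every $t\in[0,1)$ and $$\lim_{t\to1-}\int_0^t\psi(s)\,dX(s)=\xi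 .$$ -/

import Mathlib

open MeasureTheory Filter Topology Set
open scoped ENNReal unitInterval

noncomputable section

/-- Left-sided fractional (Weyl--Marchaud) derivative `D_{a+}^β f` on an interval with
left endpoint `a`. -/
def leftFracDeriv (β a : ℝ) (f : ℝ → ℝ) (x : ℝ) : ℝ :=
  (1 / Real.Gamma (1 - β)) *
    (f x / (x - a) ^ β + β * ∫ u in a..x, (f x - f u) / (x - u) ^ (β + 1))

/-- Right-sided fractional (Weyl--Marchaud) derivative `D_{b-}^γ g` on an interval with right
endpoint `b`, without the complex phase `(-1)^γ` (see `glsIntegral`). -/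
def rightFracDeriv (γ b : ℝ) (g : ℝ → ℝ) (x : ℝ) : ℝ :=
  (1 / Real.Gamma (1 - γ)) *
    (g x / (b - x) ^ γ + γ * ∫ u in x..b, (g x - g u) / (u - x) ^ (γ + 1))

/-- The norm `‖f‖_{β;[a,b]}`, with values in `[0,∞]`. -/
def fracNorm (β a b : ℝ) (f : ℝ → ℝ) : ℝ≥0∞ :=
  ∫⁻ t in Ioo a b, (ENNReal.ofReal (|f t| / (t - a) ^ β) +
    ∫⁻ s in Ioo a t, ENNReal.ofReal (|f t - f s| / (t - s) ^ (β + 1)))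

/-- The functional `Λ_β(g)` on `[a,b]`, with values in `[0,∞]`. -/
def fracLambda (β a b : ℝ) (g : ℝ → ℝ) : ℝ≥0∞ :=
  ⨆ (u : ℝ) (v : ℝ) (_ : a ≤ u ∧ u < v ∧ v ≤ b),
    (ENNReal.ofReal (|g v - g u| / (v - u) ^ (1 - β)) +
      ∫⁻ z in Ioo u v, ENNReal.ofReal (|g u - g z| / (z - u) ^ (2 - β)))

/-- The generalized Lebesgue--Stieltjes integral `∫_a^b f dg` of order `β` exists: `f` is an
admissible integrand, `‖f‖_{β;[a,b]} < ∞`, and `Λ_β(g) < ∞`. These conditions imply that the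
integrals defining `D_{a+}^β f` converge almost everywhere, that `D_{a+}^β f ∈ L¹[a,b]` and that
`D_{b-}^{1-β} g_{b-} ∈ L^∞[a,b]`. -/
structure GLSIntegrable (β a b : ℝ) (f g : ℝ → ℝ) : Prop where
  order_pos : 0 < β
  order_lt_one : β < 1
  aemeasurable : AEMeasurable f (volume.restrict (Ioo a b))
  fracNorm_lt_top : fracNorm β a b f < ∞
  fracLambda_lt_top : fracLambda β a b g < ∞

/-- The generalized Lebesgue--Stieltjes integral
`∫_a^b f dg = (-1)^β ∫_a^b (D_{a+}^β f)(x) (D_{b-}^{1-β} g_{b-})(x) dx`, `g_{b-} = g - g(b)`.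
The phases `(-1)^β` and `(-1)^{1-β}` multiply to `-1`, which is the sign in front; with it
`∫_a^b 1 dg = g(b) - g(a)`. -/
def glsIntegral (β a b : ℝ) (f g : ℝ → ℝ) : ℝ :=
  -∫ x in a..b, leftFracDeriv β a f x * rightFracDeriv (1 - β) b (fun y => g y - g b) x

/-- A path of a process on `[0,1]`, as a function on `ℝ` (constant outside `[0,1]`). -/
def processPath {Ω : Type*} (Y : I → Ω → ℝ) (ω : Ω) : ℝ → ℝ :=
  IccExtend zero_le_one (fun t : I => Y t ω)

/-- Almost all paths of `X` are Hölder continuous of order `a` on `[0,1]`; the Hölder constant may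
depend on the path. -/
def HasHolderPaths {Ω : Type*} [MeasurableSpace Ω] (P : Measure Ω) (X : I → Ω → ℝ)
    (a : ℝ) : Prop :=
  ∀ᵐ ω ∂P, ∃ C : ℝ, ∀ s t : I, |X t ω - X s ω| ≤ C * |(t : ℝ) - s| ^ a

/-- Small ball estimate with exponent `α` near the end point `1`. The event
`sup_{s ≤ u ≤ t} |X(u) - X(s)| ≤ ε` is written out pointwise. -/
def SmallBall {Ω : Type*} [MeasurableSpace Ω] (P : Measure Ω) (X : I → Ω → ℝ)
    (α : ℝ) : Prop :=
  ∃ δ > (0 : ℝ), ∃ C > (0 : ℝ), ∀ s t : I, 1 - δ ≤ (s : ℝ) → s ≤ t →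
    ∀ ε : ℝ, 0 < ε → ε ≤ ((t : ℝ) - s) ^ α →
      P {ω | ∀ u ∈ Icc s t, |X u ω - X s ω| ≤ ε} ≤
        ENNReal.ofReal (Real.exp (-(C * ((t : ℝ) - s) * ε ^ (-(1 / α)))))

/-- The filtration is left-continuous at `1`: `σ(⋃_{t<1} 𝓕_t) = 𝓕_1`. -/
def LeftContinuousAtOne {Ω : Type*} {m : MeasurableSpace Ω} (𝓕 : Filtration I m) : Prop :=
  (⨆ (t : I) (_ : t < 1), 𝓕 t) = 𝓕 1

end

/-!
In the `n`-th of a sequence of time blocks `[T n, T (n + 1)]` approaching `1`, hold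
`2 (X - X (T n)) / ε n ^ 2` along a fine grid until `X` has moved by `ε n`. For a step function the
generalized Lebesgue–Stieltjes integral is the Riemann sum, and since
`∑ 2 (y k) (y (k + 1) - y k) = (y N) ^ 2 - ∑ (y (k + 1) - y k) ^ 2`, the gain is close to `1` if the
exit takes place: paths of Hölder exponent `> 1 / 2` have no quadratic variation. When the `ε n` are
small enough, almost every path exits in all but finitely many blocks. Staking in each block the
difference between the target `η n` and the current wealth then contracts the wealth towards the
targets, and these are chosen `𝓕 (T n)`-measurable with `η n → ξ`.

That the integral of a step function is its Riemann sum is a Beta integral when the integrator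
is smooth; a Hölder integrator is the limit of its Steklov means, along which the fractional
derivatives converge boundedly.
-/

open scoped NNReal

theorem holderOnWith_of_forall_lt {C r : ℝ≥0} {f : ℝ → ℝ} {s : Set ℝ}
    (h : ∀ u ∈ s, ∀ v ∈ s, u < v → |f v - f u| ≤ C * (v - u) ^ (r : ℝ)) :
    HolderOnWith C r f s := by
  have hlt (u : ℝ) (hu : u ∈ s) (v : ℝ) (hv : v ∈ s) (huv : u < v) :
      edist (f u) (f v) ≤ C * edist u v ^ (r : ℝ) := by
    rw [edist_comm, edist_comm u, edist_dist, edist_dist, Real.dist_eq, Real.dist_eq,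
      abs_of_pos (sub_pos.2 huv), ENNReal.ofReal_rpow_of_pos (sub_pos.2 huv),
      ← ENNReal.ofReal_coe_nnreal, ← ENNReal.ofReal_mul C.coe_nonneg]
    exact ENNReal.ofReal_le_ofReal (h u hu v hv huv)
  intro u hu v hv
  rcases lt_trichotomy u v with huv | rfl | hvu
  · exact hlt u hu v hv huv
  · simp
  · simpa only [edist_comm] using hlt v hv u hu hvu

theorem intervalIntegrable_sub_rpow {r : ℝ} (hr : -1 < r) (p a b : ℝ) :
    IntervalIntegrable (fun x => (x - p) ^ r) volume a b := by
  simpa using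
    (intervalIntegral.intervalIntegrable_rpow' (a := a - p) (b := b - p) hr).comp_sub_right p

theorem integral_sub_rpow_mul_sub_rpow {s t p u : ℝ} (hs : 0 < s) (ht : 0 < t) (hpu : p < u) :
    ∫ x in p..u, (x - p) ^ (s - 1) * (u - x) ^ (t - 1) =
      (u - p) ^ (s + t - 1) * ProbabilityTheory.beta s t := by
  have hlen : 0 < u - p := sub_pos.2 hpu
  have hshift : ∫ x in p..u, (x - p) ^ (s - 1) * (u - x) ^ (t - 1) =
      ∫ x in (0 : ℝ)..(u - p), x ^ (s - 1) * (u - p - x) ^ (t - 1) := by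
    simpa using intervalIntegral.integral_comp_sub_right (a := p) (b := u)
      (fun x => x ^ (s - 1) * (u - p - x) ^ (t - 1)) p
  have hcomplex : ((∫ x in (0 : ℝ)..(u - p), x ^ (s - 1) * (u - p - x) ^ (t - 1) : ℝ) : ℂ) =
      (((u - p) ^ (s + t - 1) : ℝ) : ℂ) * Complex.betaIntegral s t := by
    rw [Complex.ofReal_cpow hlen.le]
    push_cast
    rw [← Complex.ofReal_sub, ← Complex.betaIntegral_scaled s t hlen,
      ← intervalIntegral.integral_ofReal]
    refine intervalIntegral.integral_congr fun x hx => ?_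
    rw [uIcc_of_le hlen.le] at hx
    rw [Complex.ofReal_mul, Complex.ofReal_cpow hx.1, Complex.ofReal_cpow (sub_nonneg.2 hx.2)]
    push_cast
    rfl
  have hre := congrArg Complex.re hcomplex
  rwa [Complex.ofReal_re, Complex.re_ofReal_mul,
    ← ProbabilityTheory.beta_eq_betaIntegralReal s t hs ht, ← hshift] at hre

theorem integral_sub_rpow_neg_mul_sub_rpow {β p u : ℝ} (hβ : β ∈ Ioo (0 : ℝ) 1) (hpu : p < u) :
    ∫ x in p..u, (x - p) ^ (-β) * (u - x) ^ (β - 1) = Real.Gamma (1 - β) * Real.Gamma β := by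
  have h := integral_sub_rpow_mul_sub_rpow (sub_pos.2 hβ.2) hβ.1 hpu
  simpa [ProbabilityTheory.beta] using h

theorem intervalIntegrable_sub_rpow_neg_mul_sub_rpow {β p u : ℝ} (hβ : β ∈ Ioo (0 : ℝ) 1)
    (hpu : p < u) :
    IntervalIntegrable (fun x => (x - p) ^ (-β) * (u - x) ^ (β - 1)) volume p u := by
  by_contra h
  have hzero := integral_sub_rpow_neg_mul_sub_rpow hβ hpu
  rw [intervalIntegral.integral_undef h] at hzero
  exact (mul_pos (Real.Gamma_pos_of_pos (sub_pos.2 hβ.2)) (Real.Gamma_pos_of_pos hβ.1)).ne hzero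

section Triangle

variable {p b : ℝ} {F : ℝ → ℝ → ℝ}

/-- The open triangle over the square of `(p, b)` above the diagonal, on which the order of
integration is exchanged. -/
def openTriangle (p b : ℝ) : Set (ℝ × ℝ) :=
  {z | p < z.1 ∧ z.1 < z.2 ∧ z.2 < b}

theorem measurableSet_openTriangle (p b : ℝ) : MeasurableSet (openTriangle p b) :=
  (measurableSet_lt measurable_const measurable_fst).inter
    ((measurableSet_lt measurable_fst measurable_snd).inter
      (measurableSet_lt measurable_snd measurable_const))

theorem openTriangle_subset_prod (p b : ℝ) : openTriangle p b ⊆ Ioo p b ×ˢ Ioo p b :=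
  fun _ hz => ⟨⟨hz.1, hz.2.1.trans hz.2.2⟩, hz.1.trans hz.2.1, hz.2.2⟩

theorem restrict_openTriangle_le (p b : ℝ) :
    volume.restrict (openTriangle p b) ≤
      (volume.restrict (Ioo p b)).prod (volume.restrict (Ioo p b)) := by
  rw [Measure.prod_restrict]
  exact Measure.restrict_mono_set _ (openTriangle_subset_prod p b)

theorem indicator_openTriangle_left {M : Type*} [Zero M] (F : ℝ → ℝ → M) (x u : ℝ) :
    (openTriangle p b).indicator (Function.uncurry F) (x, u) =
      (Ioo p b).indicator (fun x => (Ioo x b).indicator (F x) u) x := by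
  simp only [indicator_apply, openTriangle, mem_ofPred_eq, mem_Ioo, Function.uncurry_apply_pair]
  grind

theorem indicator_openTriangle_right {M : Type*} [Zero M] (F : ℝ → ℝ → M) (x u : ℝ) :
    (openTriangle p b).indicator (Function.uncurry F) (x, u) =
      (Ioo p b).indicator (fun u => (Ioo p u).indicator (fun x => F x u) x) u := by
  simp only [indicator_apply, openTriangle, mem_ofPred_eq, mem_Ioo, Function.uncurry_apply_pair]
  grind

theorem integral_indicator_openTriangle_left (F : ℝ → ℝ → ℝ) (x : ℝ) :
    ∫ u, (openTriangle p b).indicator (Function.uncurry F) (x, u) =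
      (Ioo p b).indicator (fun x => ∫ u in Ioo x b, F x u) x := by
  simp only [indicator_openTriangle_left]
  by_cases hx : x ∈ Ioo p b
  · simp only [indicator_of_mem hx, integral_indicator measurableSet_Ioo]
  · simp only [indicator_of_notMem hx, integral_zero]

theorem integral_indicator_openTriangle_right (F : ℝ → ℝ → ℝ) (u : ℝ) :
    ∫ x, (openTriangle p b).indicator (Function.uncurry F) (x, u) =
      (Ioo p b).indicator (fun u => ∫ x in Ioo p u, F x u) u := by
  simp only [indicator_openTriangle_right]
  by_cases hu : u ∈ Ioo p b
  · simp only [indicator_of_mem hu, integral_indicator measurableSet_Ioo]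
  · simp only [indicator_of_notMem hu, integral_zero]

theorem setIntegral_openTriangle_swap (hF : IntegrableOn (Function.uncurry F) (openTriangle p b)) :
    ∫ x in Ioo p b, ∫ u in Ioo x b, F x u = ∫ u in Ioo p b, ∫ x in Ioo p u, F x u := by
  have hint : Integrable (Function.uncurry fun x u =>
      (openTriangle p b).indicator (Function.uncurry F) (x, u)) (volume.prod volume) :=
    hF.integrable_indicator (measurableSet_openTriangle p b)
  have hswap := integral_integral_swap hint
  simpa only [integral_indicator_openTriangle_left, integral_indicator_openTriangle_right,
    integral_indicator measurableSet_Ioo] using hswap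

theorem integrableOn_openTriangle_of_left
    (hF : AEStronglyMeasurable (Function.uncurry F) (volume.restrict (openTriangle p b)))
    (hint : ∀ x ∈ Ioo p b, IntegrableOn (F x) (Ioo x b))
    (hnorm : IntegrableOn (fun x => ∫ u in Ioo x b, ‖F x u‖) (Ioo p b)) :
    IntegrableOn (Function.uncurry F) (openTriangle p b) := by
  have hT := measurableSet_openTriangle p b
  rw [← integrable_indicator_iff hT]
  refine (integrable_prod_iff ((aestronglyMeasurable_indicator_iff hT).2 hF)).2
    ⟨ae_of_all _ fun x => ?_, ?_⟩
  · simp only [indicator_openTriangle_left]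
    by_cases hx : x ∈ Ioo p b
    · simpa only [indicator_of_mem hx] using (hint x hx).integrable_indicator measurableSet_Ioo
    · simp only [indicator_of_notMem hx]
      exact integrable_zero _ _ _
  · rw [← integrable_indicator_iff measurableSet_Ioo] at hnorm
    refine hnorm.congr (ae_of_all _ fun x => ?_)
    rw [← integral_indicator_openTriangle_left]
    simp only [norm_indicator_eq_indicator_norm]
    rfl

theorem integrableOn_openTriangle_of_right
    (hF : AEStronglyMeasurable (Function.uncurry F) (volume.restrict (openTriangle p b)))
    (hint : ∀ u ∈ Ioo p b, IntegrableOn (fun x => F x u) (Ioo p u))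
    (hnorm : IntegrableOn (fun u => ∫ x in Ioo p u, ‖F x u‖) (Ioo p b)) :
    IntegrableOn (Function.uncurry F) (openTriangle p b) := by
  have hT := measurableSet_openTriangle p b
  rw [← integrable_indicator_iff hT]
  refine (integrable_prod_iff' ((aestronglyMeasurable_indicator_iff hT).2 hF)).2
    ⟨ae_of_all _ fun u => ?_, ?_⟩
  · simp only [indicator_openTriangle_right]
    by_cases hu : u ∈ Ioo p b
    · simpa only [indicator_of_mem hu] using (hint u hu).integrable_indicator measurableSet_Ioo
    · simp only [indicator_of_notMem hu]
      exact integrable_zero _ _ _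
  · rw [← integrable_indicator_iff measurableSet_Ioo] at hnorm
    refine hnorm.congr (ae_of_all _ fun u => ?_)
    rw [← integral_indicator_openTriangle_right]
    simp only [norm_indicator_eq_indicator_norm]
    rfl

end Triangle

theorem setIntegral_kernel_convolution {β p b : ℝ} {h : ℝ → ℝ} (hβ : β ∈ Ioo (0 : ℝ) 1)
    (hh : IntegrableOn h (Ioo p b)) :
    ∫ x in Ioo p b, (x - p) ^ (-β) * ∫ u in Ioo x b, (u - x) ^ (β - 1) * h u =
      Real.Gamma (1 - β) * Real.Gamma β * ∫ u in Ioo p b, h u := by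
  have hkernel (u : ℝ) (hu : u ∈ Ioo p b) :
      ∫ x in Ioo p u, (x - p) ^ (-β) * (u - x) ^ (β - 1) =
        Real.Gamma (1 - β) * Real.Gamma β := by
    rw [← integral_Ioc_eq_integral_Ioo, ← intervalIntegral.integral_of_le hu.1.le,
      integral_sub_rpow_neg_mul_sub_rpow hβ hu.1]
  have hnorm (u : ℝ) : ∫ x in Ioo p u, ‖(x - p) ^ (-β) * ((u - x) ^ (β - 1) * h u)‖ =
      (∫ x in Ioo p u, (x - p) ^ (-β) * (u - x) ^ (β - 1)) * ‖h u‖ := by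
    rw [← integral_mul_const]
    refine setIntegral_congr_fun measurableSet_Ioo fun x hx => ?_
    have hx1 := Real.rpow_nonneg (sub_nonneg.2 hx.1.le) (-β)
    have hx2 := Real.rpow_nonneg (sub_nonneg.2 hx.2.le) (β - 1)
    simp only [norm_mul, Real.norm_of_nonneg, hx1, hx2, mul_assoc]
  have hmeas : AEStronglyMeasurable h (volume.restrict (Ioo p b)) := hh.aestronglyMeasurable
  have hint : IntegrableOn (Function.uncurry fun x u => (x - p) ^ (-β) * ((u - x) ^ (β - 1) * h u))
      (openTriangle p b) := by
    refine integrableOn_openTriangle_of_right ?_ (fun u hu => ?_) ?_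
    · have hk : Measurable fun z : ℝ × ℝ => (z.1 - p) ^ (-β) * (z.2 - z.1) ^ (β - 1) := by fun_prop
      refine (hk.aestronglyMeasurable.mul (hmeas.comp_snd.mono_measure
        (restrict_openTriangle_le p b))).congr ?_
      exact ae_of_all _ fun z => mul_assoc _ _ _
    · simp only [← mul_assoc]
      exact ((intervalIntegrable_iff_integrableOn_Ioo_of_le hu.1.le).1
        (intervalIntegrable_sub_rpow_neg_mul_sub_rpow hβ hu.1)).mul_const (h u)
    · simp only [hnorm]
      refine (integrableOn_congr_fun (fun u hu => ?_) measurableSet_Ioo).1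
        (hh.norm.const_mul (Real.Gamma (1 - β) * Real.Gamma β))
      rw [hkernel u hu]
  simp only [← integral_const_mul]
  rw [setIntegral_openTriangle_swap hint]
  refine setIntegral_congr_fun measurableSet_Ioo fun u hu => ?_
  simp only [← mul_assoc, integral_mul_const, hkernel u hu]

section SmoothIntegrator

variable {g g' : ℝ → ℝ} {x b : ℝ}

theorem integral_rpow_neg_sub_one {γ y : ℝ} (hγ : γ ≠ 0) (hxy : x < y) (hyb : y ≤ b) :
    ∫ u in Ioo y b, (u - x) ^ (-(γ + 1)) = ((y - x) ^ (-γ) - (b - x) ^ (-γ)) / γ := by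
  have hy : 0 < y - x := sub_pos.2 hxy
  have hzero : (0 : ℝ) ∉ uIcc (y - x) (b - x) := by
    rw [uIcc_of_le (by linarith)]
    exact fun h => (h.1.trans_lt' hy).false
  rw [← integral_Ioc_eq_integral_Ioo, ← intervalIntegral.integral_of_le hyb,
    intervalIntegral.integral_comp_sub_right (fun u => u ^ (-(γ + 1))),
    integral_rpow (Or.inr ⟨by contrapose! hγ; linarith, hzero⟩),
    show -(γ + 1) + 1 = -γ by ring]
  field_simp
  ring

theorem integrableOn_rpow_neg_sub_one {γ y : ℝ} (hxy : x < y) :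
    IntegrableOn (fun u => (u - x) ^ (-(γ + 1))) (Ioo y b) := by
  have hcont : ContinuousOn (fun u => (u - x) ^ (-(γ + 1))) (Icc y b) := fun u hu =>
    ((continuousAt_id.sub continuousAt_const).rpow_const
      (Or.inl (sub_pos.2 (hxy.trans_le hu.1)).ne')).continuousWithinAt
  exact (hcont.integrableOn_Icc).mono_set Ioo_subset_Icc_self

theorem integrableOn_openTriangle_mul_rpow {γ : ℝ} {h : ℝ → ℝ} (hγ : γ ∈ Ioo (0 : ℝ) 1)
    (hh : Continuous h) :
    IntegrableOn (Function.uncurry fun v u => h v * (u - x) ^ (-(γ + 1))) (openTriangle x b) := by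
  refine integrableOn_openTriangle_of_left ?_ (fun v hv => ?_) ?_
  · have hmeas : Measurable fun z : ℝ × ℝ => h z.1 * (z.2 - x) ^ (-(γ + 1)) := by
      have := hh.measurable
      fun_prop
    exact hmeas.aestronglyMeasurable
  · exact (integrableOn_rpow_neg_sub_one hv.1).const_mul (h v)
  · have hsing : IntegrableOn (fun v => (v - x) ^ (-γ)) (Ioo x b) := by
      by_cases hxb : x ≤ b
      · exact (intervalIntegrable_iff_integrableOn_Ioo_of_le hxb).1
          (intervalIntegrable_sub_rpow (by linarith [hγ.2]) x x b)
      · simp [Ioo_eq_empty (fun h => hxb h.le)]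
    have hmajor : IntegrableOn (fun v => ‖h v‖ * (((v - x) ^ (-γ) - (b - x) ^ (-γ)) / γ))
        (Ioo x b) := by
      have hconst : IntegrableOn (fun _ => (b - x) ^ (-γ)) (Ioo x b) := integrableOn_const
        (by simp)
      obtain ⟨M, hM⟩ := isCompact_Icc.exists_bound_of_continuousOn (s := Icc x b)
        hh.continuousOn
      refine ((hsing.sub hconst).div_const γ).bdd_mul (c := M) hh.norm.aestronglyMeasurable ?_
      refine (ae_restrict_iff' measurableSet_Ioo).2 (ae_of_all _ fun v hv => ?_)
      simpa using hM v (Ioo_subset_Icc_self hv)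
    refine (integrableOn_congr_fun (fun v hv => ?_) measurableSet_Ioo).1 hmajor
    rw [← integral_rpow_neg_sub_one hγ.1.ne' hv.1 hv.2.le, ← integral_const_mul]
    refine setIntegral_congr_fun measurableSet_Ioo fun u hu => ?_
    have hpos := Real.rpow_nonneg (sub_pos.2 (hv.1.trans hu.1)).le (-(γ + 1))
    rw [norm_mul, Real.norm_of_nonneg hpos]

/-- Writing `g x - g u` as an integral of `g'` and exchanging the integrals cancels the boundary
term of the fractional derivative. -/
theorem rightFracDeriv_of_hasDerivAt {γ : ℝ} (hγ : γ ∈ Ioo (0 : ℝ) 1) (hxb : x < b)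
    (hg : ∀ y, HasDerivAt g (g' y) y) (hg' : Continuous g') :
    rightFracDeriv γ b (fun y => g y - g b) x =
      -(1 / Real.Gamma (1 - γ)) * ∫ v in Ioo x b, (v - x) ^ (-γ) * g' v := by
  have hftc (u : ℝ) (hu : x ≤ u) : ∫ v in Ioo x u, g' v = g u - g x := by
    rw [← integral_Ioc_eq_integral_Ioo, ← intervalIntegral.integral_of_le hu]
    exact intervalIntegral.integral_eq_sub_of_hasDerivAt (fun y _ => hg y)
      (hg'.intervalIntegrable _ _)
  have hsing : IntegrableOn (fun v => (v - x) ^ (-γ) * g' v) (Ioo x b) :=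
    (intervalIntegrable_iff_integrableOn_Ioo_of_le hxb.le).1
      ((intervalIntegrable_sub_rpow (by linarith [hγ.2]) x x b).mul_continuousOn
        hg'.continuousOn)
  have hint : IntegrableOn g' (Ioo x b) :=
    hg'.integrableOn_Icc.mono_set Ioo_subset_Icc_self
  have hdouble : ∫ u in x..b, (g x - g u) / (u - x) ^ (γ + 1) =
      -((∫ v in Ioo x b, (v - x) ^ (-γ) * g' v) - (b - x) ^ (-γ) * (g b - g x)) / γ :=
    calc ∫ u in x..b, (g x - g u) / (u - x) ^ (γ + 1)
        = -∫ u in Ioo x b, ∫ v in Ioo x u, g' v * (u - x) ^ (-(γ + 1)) := by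
          rw [intervalIntegral.integral_of_le hxb.le, integral_Ioc_eq_integral_Ioo, ← integral_neg]
          refine setIntegral_congr_fun measurableSet_Ioo fun u hu => ?_
          rw [integral_mul_const, hftc u hu.1.le, Real.rpow_neg (sub_pos.2 hu.1).le]
          ring
      _ = -∫ v in Ioo x b, ((v - x) ^ (-γ) * g' v - (b - x) ^ (-γ) * g' v) / γ := by
          rw [← setIntegral_openTriangle_swap (integrableOn_openTriangle_mul_rpow hγ hg')]
          congr 1
          refine setIntegral_congr_fun measurableSet_Ioo fun v hv => ?_
          rw [integral_const_mul, integral_rpow_neg_sub_one hγ.1.ne' hv.1 hv.2.le]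
          ring
      _ = _ := by
          rw [integral_div, integral_sub hsing (hint.const_mul _), integral_const_mul,
            hftc b hxb.le, neg_div]
  have hγ0 := hγ.1.ne'
  simp only [rightFracDeriv, sub_sub_sub_cancel_right, hdouble]
  rw [Real.rpow_neg (sub_pos.2 hxb).le]
  field_simp
  ring

theorem integral_kernel_mul_rightFracDeriv_of_hasDerivAt {β p : ℝ} (hβ : β ∈ Ioo (0 : ℝ) 1)
    (hpb : p ≤ b) (hg : ∀ y, HasDerivAt g (g' y) y) (hg' : Continuous g') :
    ∫ x in Ioo p b, (x - p) ^ (-β) * rightFracDeriv (1 - β) b (fun y => g y - g b) x =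
      -(Real.Gamma (1 - β) * (g b - g p)) := by
  have hΓ := (Real.Gamma_pos_of_pos hβ.1).ne'
  have hftc : ∫ u in Ioo p b, g' u = g b - g p := by
    rw [← integral_Ioc_eq_integral_Ioo, ← intervalIntegral.integral_of_le hpb]
    exact intervalIntegral.integral_eq_sub_of_hasDerivAt (fun y _ => hg y)
      (hg'.intervalIntegrable _ _)
  have hderiv : ∀ x ∈ Ioo p b,
      (x - p) ^ (-β) * rightFracDeriv (1 - β) b (fun y => g y - g b) x =
        -(1 / Real.Gamma β) * ((x - p) ^ (-β) * ∫ u in Ioo x b, (u - x) ^ (β - 1) * g' u) := by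
    intro x hx
    rw [rightFracDeriv_of_hasDerivAt ⟨sub_pos.2 hβ.2, sub_lt_self 1 hβ.1⟩ hx.2 hg hg',
      sub_sub_cancel, neg_sub]
    ring
  rw [setIntegral_congr_fun measurableSet_Ioo hderiv, integral_const_mul,
    setIntegral_kernel_convolution hβ (hg'.integrableOn_Icc.mono_set Ioo_subset_Icc_self), hftc]
  field_simp

end SmoothIntegrator

section Measurability

variable {a b : ℝ} {f : ℝ → ℝ}

theorem aestronglyMeasurable_integral_openTriangle_left {F : ℝ → ℝ → ℝ}
    (hF : AEMeasurable (Function.uncurry F) (volume.restrict (openTriangle a b))) :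
    AEStronglyMeasurable (fun x => ∫ u in Ioo x b, F x u) (volume.restrict (Ioo a b)) := by
  have hind := (aemeasurable_indicator_iff (measurableSet_openTriangle a b)).2 hF
  have hint := hind.aestronglyMeasurable.integral_prod_right' (μ := volume) (ν := volume)
  simp only [integral_indicator_openTriangle_left] at hint
  exact (aestronglyMeasurable_indicator_iff measurableSet_Ioo).1 hint

theorem aestronglyMeasurable_integral_openTriangle_right {F : ℝ → ℝ → ℝ}
    (hF : AEMeasurable (Function.uncurry F) (volume.restrict (openTriangle a b))) :
    AEStronglyMeasurable (fun u => ∫ x in Ioo a u, F x u) (volume.restrict (Ioo a b)) := by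
  have hind := (aemeasurable_indicator_iff (measurableSet_openTriangle a b)).2 hF
  have hint := hind.aestronglyMeasurable.prod_swap.integral_prod_right'
    (μ := volume) (ν := volume)
  simp only [Prod.swap_prod_mk, integral_indicator_openTriangle_right] at hint
  exact (aestronglyMeasurable_indicator_iff measurableSet_Ioo).1 hint

theorem aemeasurable_lintegral_openTriangle_right {F : ℝ → ℝ → ℝ≥0∞}
    (hF : AEMeasurable (Function.uncurry F) (volume.restrict (openTriangle a b))) :
    AEMeasurable (fun u => ∫⁻ x in Ioo a u, F x u) (volume.restrict (Ioo a b)) := by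
  have hind := (aemeasurable_indicator_iff (measurableSet_openTriangle a b)).2 hF
  have hint := hind.prod_swap.lintegral_prod_right' (μ := volume) (ν := volume)
  refine (aemeasurable_indicator_iff measurableSet_Ioo).1 (hint.congr (ae_of_all _ fun u => ?_))
  simp only [Prod.swap_prod_mk, indicator_openTriangle_right]
  by_cases hu : u ∈ Ioo a b
  · simp only [indicator_of_mem hu, lintegral_indicator measurableSet_Ioo]
  · simp only [indicator_of_notMem hu, lintegral_zero]

theorem aemeasurable_sub_div_rpow_openTriangle (hf : AEMeasurable f (volume.restrict (Ioo a b)))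
    (γ : ℝ) :
    AEMeasurable (Function.uncurry fun x u => (f x - f u) / (u - x) ^ γ)
      (volume.restrict (openTriangle a b)) := by
  have hprod : AEMeasurable (fun z : ℝ × ℝ => (f z.1 - f z.2) / (z.2 - z.1) ^ γ)
      ((volume.restrict (Ioo a b)).prod (volume.restrict (Ioo a b))) :=
    (hf.comp_fst.sub hf.comp_snd).div (by fun_prop)
  exact hprod.mono_measure (restrict_openTriangle_le a b)

theorem aestronglyMeasurable_rightFracDeriv (hf : AEMeasurable f (volume.restrict (Ioo a b)))
    (γ : ℝ) :
    AEStronglyMeasurable (rightFracDeriv γ b f) (volume.restrict (Ioo a b)) := by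
  have hint := aestronglyMeasurable_integral_openTriangle_left
    (aemeasurable_sub_div_rpow_openTriangle hf (γ + 1))
  have hbdry : AEMeasurable (fun x => f x / (b - x) ^ γ) (volume.restrict (Ioo a b)) :=
    hf.div (by fun_prop)
  refine ((hbdry.aestronglyMeasurable.add (hint.const_mul γ)).const_mul
    (1 / Real.Gamma (1 - γ))).congr ?_
  refine (ae_restrict_iff' measurableSet_Ioo).2 (ae_of_all _ fun x hx => ?_)
  simp only [rightFracDeriv, Pi.add_apply, intervalIntegral.integral_of_le hx.2.le,
    integral_Ioc_eq_integral_Ioo]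

theorem aemeasurable_sub_div_rpow_openTriangle_right
    (hf : AEMeasurable f (volume.restrict (Ioo a b))) (γ : ℝ) :
    AEMeasurable (Function.uncurry fun u x => (f x - f u) / (x - u) ^ γ)
      (volume.restrict (openTriangle a b)) := by
  refine (aemeasurable_sub_div_rpow_openTriangle hf γ).neg.congr (ae_of_all _ fun z => ?_)
  simp only [Pi.neg_apply, Function.uncurry, ← neg_div, neg_sub]

theorem aestronglyMeasurable_leftFracDeriv (hf : AEMeasurable f (volume.restrict (Ioo a b)))
    (β : ℝ) :
    AEStronglyMeasurable (leftFracDeriv β a f) (volume.restrict (Ioo a b)) := by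
  have hint := aestronglyMeasurable_integral_openTriangle_right
    (aemeasurable_sub_div_rpow_openTriangle_right hf (β + 1))
  have hbdry : AEMeasurable (fun x => f x / (x - a) ^ β) (volume.restrict (Ioo a b)) :=
    hf.div (by fun_prop)
  refine ((hbdry.aestronglyMeasurable.add (hint.const_mul β)).const_mul
    (1 / Real.Gamma (1 - β))).congr ?_
  refine (ae_restrict_iff' measurableSet_Ioo).2 (ae_of_all _ fun x hx => ?_)
  simp only [leftFracDeriv, Pi.add_apply, intervalIntegral.integral_of_le hx.1.le,
    integral_Ioc_eq_integral_Ioo]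

theorem aemeasurable_fracNorm_inner (hf : AEMeasurable f (volume.restrict (Ioo a b))) (β : ℝ) :
    AEMeasurable (fun t => ∫⁻ s in Ioo a t, ENNReal.ofReal (|f t - f s| / (t - s) ^ (β + 1)))
      (volume.restrict (Ioo a b)) := by
  refine aemeasurable_lintegral_openTriangle_right ?_
  have hprod : AEMeasurable
      (fun z : ℝ × ℝ => ENNReal.ofReal (|f z.2 - f z.1| / (z.2 - z.1) ^ (β + 1)))
      ((volume.restrict (Ioo a b)).prod (volume.restrict (Ioo a b))) :=
    (AEMeasurable.div (hf.comp_snd.sub hf.comp_fst).norm (by fun_prop)).ennreal_ofReal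
  exact hprod.mono_measure (restrict_openTriangle_le a b)

end Measurability

section Linearity

variable {β a b : ℝ} {f f₁ f₂ g : ℝ → ℝ}

theorem fracNorm_congr (h : EqOn f₁ f₂ (Ioo a b)) : fracNorm β a b f₁ = fracNorm β a b f₂ := by
  refine setLIntegral_congr_fun measurableSet_Ioo fun t ht => ?_
  simp only [h ht]
  congr 1
  refine setLIntegral_congr_fun measurableSet_Ioo fun s hs => ?_
  simp only [h ⟨hs.1, hs.2.trans ht.2⟩]

theorem leftFracDeriv_congr {x : ℝ} (hx : x ∈ Ioo a b) (h : EqOn f₁ f₂ (Ioo a b)) :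
    leftFracDeriv β a f₁ x = leftFracDeriv β a f₂ x := by
  have hint : ∫ u in a..x, (f₁ x - f₁ u) / (x - u) ^ (β + 1) =
      ∫ u in a..x, (f₂ x - f₂ u) / (x - u) ^ (β + 1) := by
    rw [intervalIntegral.integral_of_le hx.1.le, intervalIntegral.integral_of_le hx.1.le,
      integral_Ioc_eq_integral_Ioo, integral_Ioc_eq_integral_Ioo]
    refine setIntegral_congr_fun measurableSet_Ioo fun u hu => ?_
    simp only [h hx, h ⟨hu.1, hu.2.trans hx.2⟩]
  rw [leftFracDeriv, leftFracDeriv, hint, h hx]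

theorem glsIntegral_congr (hab : a ≤ b) (h : EqOn f₁ f₂ (Ioo a b)) :
    glsIntegral β a b f₁ g = glsIntegral β a b f₂ g := by
  simp only [glsIntegral, intervalIntegral.integral_of_le hab, integral_Ioc_eq_integral_Ioo]
  congr 1
  refine setIntegral_congr_fun measurableSet_Ioo fun x hx => ?_
  simp only [leftFracDeriv_congr hx h]

theorem GLSIntegrable.congr (hf : GLSIntegrable β a b f₁ g) (h : EqOn f₁ f₂ (Ioo a b)) :
    GLSIntegrable β a b f₂ g where
  order_pos := hf.order_pos
  order_lt_one := hf.order_lt_one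
  aemeasurable := hf.aemeasurable.congr
    ((ae_restrict_iff' measurableSet_Ioo).2 (ae_of_all _ fun _ hx => h hx))
  fracNorm_lt_top := fracNorm_congr (β := β) h ▸ hf.fracNorm_lt_top
  fracLambda_lt_top := hf.fracLambda_lt_top

theorem ofReal_abs_add_div_le (x y : ℝ) {z : ℝ} (hz : 0 ≤ z) :
    ENNReal.ofReal (|x + y| / z) ≤ ENNReal.ofReal (|x| / z) + ENNReal.ofReal (|y| / z) := by
  rw [← ENNReal.ofReal_add (by positivity) (by positivity), ← add_div]
  gcongr
  exact abs_add_le x y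

theorem fracNorm_add_le (hf : AEMeasurable f₁ (volume.restrict (Ioo a b))) :
    fracNorm β a b (f₁ + f₂) ≤ fracNorm β a b f₁ + fracNorm β a b f₂ := by
  have hbdry : AEMeasurable (fun t => ENNReal.ofReal (|f₁ t| / (t - a) ^ β))
      (volume.restrict (Ioo a b)) := (AEMeasurable.div hf.norm (by fun_prop)).ennreal_ofReal
  refine le_of_le_of_eq ?_ (lintegral_add_left' (hbdry.add (aemeasurable_fracNorm_inner hf β)) _)
  refine setLIntegral_mono' measurableSet_Ioo fun t ht =>
    (add_le_add ?_ ?_).trans_eq (add_add_add_comm _ _ _ _)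
  · exact ofReal_abs_add_div_le _ _ (Real.rpow_nonneg (sub_pos.2 ht.1).le _)
  · have hft : AEMeasurable f₁ (volume.restrict (Ioo a t)) :=
      hf.mono_measure (Measure.restrict_mono_set _ (Ioo_subset_Ioo_right ht.2.le))
    have hmeas : AEMeasurable (fun s => ENNReal.ofReal (|f₁ t - f₁ s| / (t - s) ^ (β + 1)))
        (volume.restrict (Ioo a t)) :=
      (AEMeasurable.div (hft.const_sub _).norm (by fun_prop)).ennreal_ofReal
    rw [← lintegral_add_left' hmeas]
    refine setLIntegral_mono' measurableSet_Ioo fun s hs => ?_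
    rw [Pi.add_apply, Pi.add_apply, add_sub_add_comm]
    exact ofReal_abs_add_div_le _ _ (Real.rpow_nonneg (sub_pos.2 hs.2).le _)

theorem fracNorm_const_mul (c : ℝ) :
    fracNorm β a b (fun x => c * f x) = ENNReal.ofReal |c| * fracNorm β a b f := by
  simp only [fracNorm, ← mul_sub, abs_mul, mul_div_assoc, ENNReal.ofReal_mul (abs_nonneg c),
    lintegral_const_mul' _ _ ENNReal.ofReal_ne_top, ← mul_add]

theorem GLSIntegrable.add (h₁ : GLSIntegrable β a b f₁ g) (h₂ : GLSIntegrable β a b f₂ g) :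
    GLSIntegrable β a b (f₁ + f₂) g where
  order_pos := h₁.order_pos
  order_lt_one := h₁.order_lt_one
  aemeasurable := h₁.aemeasurable.add h₂.aemeasurable
  fracNorm_lt_top := (fracNorm_add_le h₁.aemeasurable).trans_lt
    (ENNReal.add_lt_top.2 ⟨h₁.fracNorm_lt_top, h₂.fracNorm_lt_top⟩)
  fracLambda_lt_top := h₁.fracLambda_lt_top

theorem GLSIntegrable.const_mul (h : GLSIntegrable β a b f g) (c : ℝ) :
    GLSIntegrable β a b (fun x => c * f x) g where
  order_pos := h.order_pos
  order_lt_one := h.order_lt_one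
  aemeasurable := h.aemeasurable.const_mul c
  fracNorm_lt_top := by
    rw [fracNorm_const_mul]
    exact ENNReal.mul_lt_top ENNReal.ofReal_lt_top h.fracNorm_lt_top
  fracLambda_lt_top := h.fracLambda_lt_top

theorem GLSIntegrable.zero (hβ : β ∈ Ioo (0 : ℝ) 1) (hg : fracLambda β a b g < ∞) :
    GLSIntegrable β a b 0 g where
  order_pos := hβ.1
  order_lt_one := hβ.2
  aemeasurable := aemeasurable_const
  fracNorm_lt_top := by simp [fracNorm]
  fracLambda_lt_top := hg

theorem GLSIntegrable.sum {ι : Type*} {s : Finset ι} {F : ι → ℝ → ℝ} (hβ : β ∈ Ioo (0 : ℝ) 1)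
    (hg : fracLambda β a b g < ∞) (hF : ∀ i ∈ s, GLSIntegrable β a b (F i) g) :
    GLSIntegrable β a b (∑ i ∈ s, F i) g :=
  Finset.sum_induction F (GLSIntegrable β a b · g) (fun _ _ => GLSIntegrable.add) (.zero hβ hg) hF

theorem leftFracDeriv_const_mul (c x : ℝ) :
    leftFracDeriv β a (fun y => c * f y) x = c * leftFracDeriv β a f x := by
  simp only [leftFracDeriv, ← mul_sub, mul_div_assoc, intervalIntegral.integral_const_mul]
  ring

theorem leftFracDeriv_add {x : ℝ}
    (h₁ : IntervalIntegrable (fun u => (f₁ x - f₁ u) / (x - u) ^ (β + 1)) volume a x)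
    (h₂ : IntervalIntegrable (fun u => (f₂ x - f₂ u) / (x - u) ^ (β + 1)) volume a x) :
    leftFracDeriv β a (f₁ + f₂) x = leftFracDeriv β a f₁ x + leftFracDeriv β a f₂ x := by
  simp only [leftFracDeriv, Pi.add_apply, add_sub_add_comm, add_div]
  rw [intervalIntegral.integral_add h₁ h₂]
  ring

theorem GLSIntegrable.ae_intervalIntegrable (h : GLSIntegrable β a b f g) :
    ∀ᵐ x ∂volume.restrict (Ioo a b),
      IntervalIntegrable (fun u => (f x - f u) / (x - u) ^ (β + 1)) volume a x := by
  have hfin : ∀ᵐ x ∂volume.restrict (Ioo a b),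
      ∫⁻ u in Ioo a x, ENNReal.ofReal (|f x - f u| / (x - u) ^ (β + 1)) < ∞ := by
    refine ae_lt_top' (aemeasurable_fracNorm_inner h.aemeasurable β) (ne_top_of_le_ne_top
      h.fracNorm_lt_top.ne (lintegral_mono fun x => le_add_self))
  filter_upwards [hfin, ae_restrict_mem measurableSet_Ioo] with x hx hxab
  rw [intervalIntegrable_iff_integrableOn_Ioo_of_le hxab.1.le]
  have hfx : AEMeasurable f (volume.restrict (Ioo a x)) :=
    h.aemeasurable.mono_measure (Measure.restrict_mono_set _ (Ioo_subset_Ioo_right hxab.2.le))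
  refine ⟨(AEMeasurable.div (hfx.const_sub _) (by fun_prop)).aestronglyMeasurable, ?_⟩
  rw [hasFiniteIntegral_iff_norm]
  refine lt_of_le_of_lt (setLIntegral_mono' measurableSet_Ioo fun u hu => ?_) hx
  rw [norm_div, Real.norm_eq_abs, Real.norm_of_nonneg (Real.rpow_nonneg (sub_pos.2 hu.2).le _)]

theorem enorm_leftFracDeriv_le {x : ℝ} (hβ : β ∈ Ioo (0 : ℝ) 1) (hx : a < x) :
    ‖leftFracDeriv β a f x‖ₑ ≤ ENNReal.ofReal (1 / Real.Gamma (1 - β)) *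
      (ENNReal.ofReal (|f x| / (x - a) ^ β) +
        ∫⁻ u in Ioo a x, ENNReal.ofReal (|f x - f u| / (x - u) ^ (β + 1))) := by
  have hΓ : 0 ≤ 1 / Real.Gamma (1 - β) :=
    (one_div_pos.2 (Real.Gamma_pos_of_pos (sub_pos.2 hβ.2))).le
  have hbdry : ‖f x / (x - a) ^ β‖ₑ = ENNReal.ofReal (|f x| / (x - a) ^ β) := by
    rw [Real.enorm_eq_ofReal_abs, abs_div, abs_of_nonneg (Real.rpow_nonneg (sub_pos.2 hx).le β)]
  have hint : ‖∫ u in a..x, (f x - f u) / (x - u) ^ (β + 1)‖ₑ ≤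
      ∫⁻ u in Ioo a x, ENNReal.ofReal (|f x - f u| / (x - u) ^ (β + 1)) := by
    rw [intervalIntegral.integral_of_le hx.le, integral_Ioc_eq_integral_Ioo]
    refine (enorm_integral_le_lintegral_enorm _).trans
      (setLIntegral_mono' measurableSet_Ioo fun u hu => ?_)
    rw [Real.enorm_eq_ofReal_abs, abs_div,
      abs_of_nonneg (Real.rpow_nonneg (sub_pos.2 hu.2).le _)]
  have hβle : ‖β‖ₑ ≤ 1 := by
    rw [Real.enorm_eq_ofReal hβ.1.le]
    exact ENNReal.ofReal_le_one.2 hβ.2.le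
  rw [leftFracDeriv, enorm_mul, Real.enorm_eq_ofReal hΓ]
  gcongr
  refine (enorm_add_le _ _).trans (add_le_add hbdry.le ?_)
  rw [enorm_mul]
  exact (mul_le_of_le_one_left' hβle).trans hint

theorem GLSIntegrable.integrableOn_leftFracDeriv (h : GLSIntegrable β a b f g) :
    IntegrableOn (leftFracDeriv β a f) (Ioo a b) := by
  refine ⟨aestronglyMeasurable_leftFracDeriv h.aemeasurable β, ?_⟩
  refine (setLIntegral_mono' measurableSet_Ioo fun x hx =>
    enorm_leftFracDeriv_le ⟨h.order_pos, h.order_lt_one⟩ hx.1).trans_lt ?_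
  rw [lintegral_const_mul' _ _ ENNReal.ofReal_ne_top]
  exact ENNReal.mul_lt_top ENNReal.ofReal_lt_top h.fracNorm_lt_top

theorem le_fracLambda {u v : ℝ} (hu : a ≤ u) (huv : u < v) (hv : v ≤ b) :
    ENNReal.ofReal (|g v - g u| / (v - u) ^ (1 - β)) +
      ∫⁻ z in Ioo u v, ENNReal.ofReal (|g u - g z| / (z - u) ^ (2 - β)) ≤ fracLambda β a b g :=
  le_iSup₂_of_le u v (le_iSup_of_le ⟨hu, huv, hv⟩ le_rfl)

theorem continuousOn_of_fracLambda_lt_top (hβ : β < 1) (hg : fracLambda β a b g < ∞) :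
    ContinuousOn g (Icc a b) := by
  have hholder : HolderOnWith (fracLambda β a b g).toNNReal ⟨1 - β, (sub_pos.2 hβ).le⟩ g
      (Icc a b) := by
    refine holderOnWith_of_forall_lt fun u hu v hv huv => ?_
    rw [← div_le_iff₀ (Real.rpow_pos_of_pos (sub_pos.2 huv) _), ENNReal.coe_toNNReal_eq_toReal,
      ← ENNReal.ofReal_le_iff_le_toReal hg.ne]
    exact le_self_add.trans (le_fracLambda hu.1 huv hv.2)
  exact hholder.continuousOn (sub_pos.2 hβ)

theorem aemeasurable_of_fracLambda_lt_top (hβ : β < 1) (hg : fracLambda β a b g < ∞) :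
    AEMeasurable g (volume.restrict (Ioo a b)) :=
  ((continuousOn_of_fracLambda_lt_top hβ hg).mono Ioo_subset_Icc_self).aemeasurable
    measurableSet_Ioo

theorem enorm_rightFracDeriv_le {x : ℝ} (hβ : β ∈ Ioo (0 : ℝ) 1) (hx : x ∈ Ico a b) :
    ‖rightFracDeriv (1 - β) b (fun y => g y - g b) x‖ₑ ≤
      ENNReal.ofReal (1 / Real.Gamma β) * fracLambda β a b g := by
  have hbdry : ‖(g x - g b) / (b - x) ^ (1 - β)‖ₑ =
      ENNReal.ofReal (|g b - g x| / (b - x) ^ (1 - β)) := by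
    rw [Real.enorm_eq_ofReal_abs, abs_div, abs_sub_comm,
      abs_of_nonneg (Real.rpow_nonneg (sub_pos.2 hx.2).le _)]
  have hint : ‖∫ u in x..b, (g x - g u) / (u - x) ^ (1 - β + 1)‖ₑ ≤
      ∫⁻ z in Ioo x b, ENNReal.ofReal (|g x - g z| / (z - x) ^ (2 - β)) := by
    rw [intervalIntegral.integral_of_le hx.2.le, integral_Ioc_eq_integral_Ioo]
    refine (enorm_integral_le_lintegral_enorm _).trans
      (setLIntegral_mono' measurableSet_Ioo fun z hz => ?_)
    rw [Real.enorm_eq_ofReal_abs, abs_div, show 1 - β + 1 = 2 - β by ring,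
      abs_of_nonneg (Real.rpow_nonneg (sub_pos.2 hz.1).le _)]
  have hβle : ‖1 - β‖ₑ ≤ 1 := by
    rw [Real.enorm_eq_ofReal (sub_pos.2 hβ.2).le]
    exact ENNReal.ofReal_le_one.2 (by linarith [hβ.1])
  have hΓ : 0 ≤ 1 / Real.Gamma β := (one_div_pos.2 (Real.Gamma_pos_of_pos hβ.1)).le
  simp only [rightFracDeriv, sub_sub_sub_cancel_right, sub_sub_cancel]
  rw [enorm_mul, Real.enorm_eq_ofReal hΓ]
  gcongr
  refine le_trans ?_ (le_fracLambda hx.1 hx.2 le_rfl)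
  refine (enorm_add_le _ _).trans (add_le_add hbdry.le ?_)
  rw [enorm_mul]
  exact (mul_le_of_le_one_left' hβle).trans hint

theorem norm_rightFracDeriv_le {x : ℝ} (hβ : β ∈ Ioo (0 : ℝ) 1) (hg : fracLambda β a b g < ∞)
    (hx : x ∈ Ico a b) :
    ‖rightFracDeriv (1 - β) b (fun y => g y - g b) x‖ ≤
      1 / Real.Gamma β * (fracLambda β a b g).toReal := by
  have hΓ : 0 ≤ 1 / Real.Gamma β := (one_div_pos.2 (Real.Gamma_pos_of_pos hβ.1)).le
  have h := ENNReal.toReal_mono (ENNReal.mul_lt_top ENNReal.ofReal_lt_top hg).ne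
    (enorm_rightFracDeriv_le hβ hx)
  rwa [toReal_enorm, ENNReal.toReal_mul, ENNReal.toReal_ofReal hΓ] at h

theorem integrableOn_mul_rightFracDeriv {k : ℝ → ℝ} (hk : IntegrableOn k (Ioo a b))
    (hβ : β ∈ Ioo (0 : ℝ) 1) (hg : fracLambda β a b g < ∞) :
    IntegrableOn (fun x => k x * rightFracDeriv (1 - β) b (fun y => g y - g b) x) (Ioo a b) := by
  have hmeas := aestronglyMeasurable_rightFracDeriv
    ((aemeasurable_of_fracLambda_lt_top hβ.2 hg).sub_const (g b)) (1 - β)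
  exact Integrable.mul_bdd hk hmeas ((ae_restrict_iff' measurableSet_Ioo).2
    (ae_of_all _ fun x hx => norm_rightFracDeriv_le hβ hg (Ioo_subset_Ico_self hx)))

theorem glsIntegral_eq_neg_setIntegral (hab : a ≤ b) :
    glsIntegral β a b f g =
      -∫ x in Ioo a b, leftFracDeriv β a f x * rightFracDeriv (1 - β) b (fun y => g y - g b) x := by
  rw [glsIntegral, intervalIntegral.integral_of_le hab, integral_Ioc_eq_integral_Ioo]

theorem glsIntegral_const_mul (c : ℝ) :
    glsIntegral β a b (fun x => c * f x) g = c * glsIntegral β a b f g := by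
  simp only [glsIntegral, leftFracDeriv_const_mul, mul_assoc, intervalIntegral.integral_const_mul,
    mul_neg]

theorem glsIntegral_zero : glsIntegral β a b 0 g = 0 := by
  simp [glsIntegral, leftFracDeriv]

theorem glsIntegral_add (hab : a ≤ b) (h₁ : GLSIntegrable β a b f₁ g)
    (h₂ : GLSIntegrable β a b f₂ g) :
    glsIntegral β a b (f₁ + f₂) g = glsIntegral β a b f₁ g + glsIntegral β a b f₂ g := by
  have hβ : β ∈ Ioo (0 : ℝ) 1 := ⟨h₁.order_pos, h₁.order_lt_one⟩
  have hg := h₁.fracLambda_lt_top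
  simp only [glsIntegral_eq_neg_setIntegral hab, ← neg_add]
  rw [← integral_add (integrableOn_mul_rightFracDeriv h₁.integrableOn_leftFracDeriv hβ hg)
    (integrableOn_mul_rightFracDeriv h₂.integrableOn_leftFracDeriv hβ hg)]
  congr 1
  refine integral_congr_ae ?_
  filter_upwards [h₁.ae_intervalIntegrable, h₂.ae_intervalIntegrable] with x hx₁ hx₂
  rw [leftFracDeriv_add hx₁ hx₂, add_mul]

theorem glsIntegral_sum {ι : Type*} {s : Finset ι} {F : ι → ℝ → ℝ} (hab : a ≤ b)
    (hF : ∀ i ∈ s, GLSIntegrable β a b (F i) g) :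
    glsIntegral β a b (∑ i ∈ s, F i) g = ∑ i ∈ s, glsIntegral β a b (F i) g := by
  classical
  induction s using Finset.induction_on with
  | empty => simp [glsIntegral_zero]
  | insert i s hi ih =>
    have hi' := hF i (Finset.mem_insert_self i s)
    have hs := fun j hj => hF j (Finset.mem_insert_of_mem hj)
    have hsum : GLSIntegrable β a b (∑ i ∈ s, F i) g :=
      .sum ⟨hi'.order_pos, hi'.order_lt_one⟩ hi'.fracLambda_lt_top hs
    rw [Finset.sum_insert hi, Finset.sum_insert hi, glsIntegral_add hab hi' hsum, ih hs]

end Linearity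

section HolderIntegrator

variable {C r : ℝ≥0} {g : ℝ → ℝ}

theorem abs_sub_le_of_holderWith (hg : HolderWith C r g) (x y : ℝ) :
    |g x - g y| ≤ C * |x - y| ^ (r : ℝ) := by
  simpa only [Real.dist_eq] using hg.dist_le x y

theorem abs_sub_div_rpow_le {γ x u : ℝ} (hg : HolderWith C r g) (hxu : x < u) :
    |g x - g u| / (u - x) ^ γ ≤ C * (u - x) ^ (r - γ) := by
  have hpos : 0 < u - x := sub_pos.2 hxu
  rw [div_le_iff₀ (Real.rpow_pos_of_pos hpos γ), mul_assoc, ← Real.rpow_add hpos,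
    sub_add_cancel, ← abs_of_pos hpos, abs_sub_comm u x]
  exact abs_sub_le_of_holderWith hg x u

theorem lintegral_abs_sub_div_rpow_le {γ u v : ℝ} (hg : HolderWith C r g) (hγ : γ < r)
    (huv : u ≤ v) :
    ∫⁻ z in Ioo u v, ENNReal.ofReal (|g u - g z| / (z - u) ^ (1 + γ)) ≤
      ENNReal.ofReal (C * ((v - u) ^ (r - γ) / (r - γ))) := by
  have hint : IntegrableOn (fun z => C * (z - u) ^ (r - γ - 1)) (Ioo u v) :=
    (intervalIntegrable_iff_integrableOn_Ioo_of_le huv).1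
      ((intervalIntegrable_sub_rpow (by linarith) u u v).const_mul _)
  calc ∫⁻ z in Ioo u v, ENNReal.ofReal (|g u - g z| / (z - u) ^ (1 + γ))
      ≤ ∫⁻ z in Ioo u v, ENNReal.ofReal (C * (z - u) ^ (r - γ - 1)) := by
        refine setLIntegral_mono' measurableSet_Ioo fun z hz => ENNReal.ofReal_le_ofReal ?_
        rw [sub_sub, add_comm γ]
        exact abs_sub_div_rpow_le hg hz.1
    _ = ENNReal.ofReal (∫ z in Ioo u v, C * (z - u) ^ (r - γ - 1)) := by
        refine (ofReal_integral_eq_lintegral_ofReal hint ?_).symm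
        filter_upwards [self_mem_ae_restrict measurableSet_Ioo] with z hz
        exact mul_nonneg C.2 (Real.rpow_nonneg (sub_pos.2 hz.1).le _)
    _ = ENNReal.ofReal (C * ((v - u) ^ (r - γ) / (r - γ))) := by
        rw [← integral_Ioc_eq_integral_Ioo, ← intervalIntegral.integral_of_le huv,
          intervalIntegral.integral_const_mul,
          intervalIntegral.integral_comp_sub_right (· ^ ((r : ℝ) - γ - 1)), sub_self,
          integral_rpow (Or.inl (by linarith)), sub_add_cancel,
          Real.zero_rpow (sub_pos.2 hγ).ne', sub_zero]

theorem fracLambda_le_of_holderWith {β a b : ℝ} (hg : HolderWith C r g) (hr : 1 - β < r) :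
    fracLambda β a b g ≤ ENNReal.ofReal
      (C * (b - a) ^ (r - (1 - β)) + C * ((b - a) ^ (r - (1 - β)) / (r - (1 - β)))) := by
  have hexp : 0 < r - (1 - β) := sub_pos.2 hr
  refine iSup₂_le fun u v => iSup_le fun ⟨_, huv, _⟩ => ?_
  have hlen : 0 < v - u := sub_pos.2 huv
  have hpow : (v - u) ^ (r - (1 - β)) ≤ (b - a) ^ (r - (1 - β)) :=
    Real.rpow_le_rpow hlen.le (by linarith) hexp.le
  have hba : 0 ≤ (b - a) ^ (r - (1 - β)) := (Real.rpow_nonneg hlen.le _).trans hpow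
  rw [ENNReal.ofReal_add (by positivity) (by positivity)]
  refine add_le_add (ENNReal.ofReal_le_ofReal ?_) ?_
  · rw [abs_sub_comm]
    exact (abs_sub_div_rpow_le hg huv).trans (mul_le_mul_of_nonneg_left hpow C.2)
  · rw [show 2 - β = 1 + (1 - β) by ring]
    refine (lintegral_abs_sub_div_rpow_le hg hr huv.le).trans (ENNReal.ofReal_le_ofReal ?_)
    gcongr

theorem fracLambda_lt_top_of_holderWith {β a b : ℝ} (hg : HolderWith C r g) (hr : 1 - β < r) :
    fracLambda β a b g < ∞ :=
  (fracLambda_le_of_holderWith hg hr).trans_lt ENNReal.ofReal_lt_top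

/-- The mean of `g` over the interval between `x` and `x + h`. Steklov means regularise a continuous
function without increasing its Hölder constant. -/
noncomputable def steklovMean (h : ℝ) (g : ℝ → ℝ) (x : ℝ) : ℝ :=
  ∫ y in (0 : ℝ)..1, g (x + h * y)

theorem hasDerivAt_steklovMean {h : ℝ} (hh : h ≠ 0) (hg : Continuous g) (x : ℝ) :
    HasDerivAt (steklovMean h g) (h⁻¹ * (g (x + h) - g x)) x := by
  have hprim (y : ℝ) : HasDerivAt (fun z => ∫ w in (0 : ℝ)..z, g w) (g y) y :=
    intervalIntegral.integral_hasDerivAt_right (hg.intervalIntegrable _ _)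
      hg.stronglyMeasurable.stronglyMeasurableAtFilter hg.continuousAt
  have heq : steklovMean h g =
      fun x => h⁻¹ * ((∫ w in (0 : ℝ)..x + h, g w) - ∫ w in (0 : ℝ)..x, g w) := by
    ext x
    rw [steklovMean, intervalIntegral.integral_comp_add_mul g hh x, smul_eq_mul, mul_zero,
      mul_one, add_zero, intervalIntegral.integral_interval_sub_left
        (hg.intervalIntegrable _ _) (hg.intervalIntegrable _ _)]
  rw [heq]
  exact (((hprim (x + h)).comp_add_const x h).sub (hprim x)).const_mul _

theorem holderWith_steklovMean (hr : 0 < r) (hg : HolderWith C r g) (h : ℝ) :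
    HolderWith C r (steklovMean h g) := by
  have hcont (x : ℝ) : IntervalIntegrable (fun y => g (x + h * y)) volume 0 1 :=
    ((hg.continuous hr).comp (by fun_prop)).intervalIntegrable _ _
  refine holderOnWith_univ.1 (holderOnWith_of_forall_lt fun u _ v _ huv => ?_)
  rw [steklovMean, steklovMean, ← intervalIntegral.integral_sub (hcont v) (hcont u)]
  refine (intervalIntegral.norm_integral_le_of_norm_le_const (E := ℝ) fun y _ => ?_).trans_eq
    (by rw [sub_zero, abs_one, mul_one])
  simpa only [Real.norm_eq_abs, add_sub_add_right_eq_sub, abs_of_pos (sub_pos.2 huv)] using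
    abs_sub_le_of_holderWith hg (v + h * y) (u + h * y)

theorem tendsto_steklovMean (hg : Continuous g) (x : ℝ) :
    Tendsto (fun h => steklovMean h g x) (𝓝[≠] 0) (𝓝 (g x)) := by
  have hcont : Continuous fun h => steklovMean h g x :=
    intervalIntegral.continuous_parametric_intervalIntegral_of_continuous'
      (f := fun h y => g (x + h * y)) (hg.comp (by fun_prop)) 0 1
  have h0 : steklovMean 0 g x = g x := by simp [steklovMean]
  exact h0 ▸ (hcont.tendsto 0).mono_left nhdsWithin_le_nhds

theorem tendsto_rightFracDeriv {ι : Type*} {l : Filter ι} [l.IsCountablyGenerated] {γ x b : ℝ}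
    {G : ι → ℝ → ℝ} (hr : 0 < r) (hγ : γ < r) (hxb : x < b)
    (hG : ∀ i, HolderWith C r (G i))
    (hlim : ∀ y, Tendsto (fun i => G i y) l (𝓝 (g y))) :
    Tendsto (fun i => rightFracDeriv γ b (fun y => G i y - G i b) x) l
      (𝓝 (rightFracDeriv γ b (fun y => g y - g b) x)) := by
  simp only [rightFracDeriv, sub_sub_sub_cancel_right]
  refine ((((hlim x).sub (hlim b)).div_const _).add (Tendsto.const_mul _ ?_)).const_mul _
  refine intervalIntegral.tendsto_integral_filter_of_dominated_convergence
    (fun u => C * (u - x) ^ (r - (γ + 1))) (.of_forall fun i => ?_)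
    (.of_forall fun i => ae_of_all _ fun u hu => ?_)
    ((intervalIntegrable_sub_rpow (by linarith) x x b).const_mul C)
    (ae_of_all _ fun u _ => ((hlim x).sub (hlim u)).div_const _)
  · have hm : Measurable (G i) := ((hG i).continuous hr).measurable
    exact Measurable.aestronglyMeasurable (by fun_prop)
  · rw [uIoc_of_le hxb.le] at hu
    rw [norm_div, Real.norm_of_nonneg (Real.rpow_nonneg (sub_pos.2 hu.1).le _)]
    exact abs_sub_div_rpow_le (hG i) hu.1

theorem integrableOn_sub_rpow_neg {β : ℝ} (hβ : β < 1) (p b : ℝ) :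
    IntegrableOn (fun x => (x - p) ^ (-β)) (Ioo p b) := by
  rcases le_total p b with hpb | hbp
  · exact (intervalIntegrable_iff_integrableOn_Ioo_of_le hpb).1
      (intervalIntegrable_sub_rpow (by linarith) p p b)
  · rw [Ioo_eq_empty hbp.not_gt]
    exact integrableOn_empty

theorem tendsto_integral_kernel_mul_rightFracDeriv {ι : Type*} {l : Filter ι}
    [l.IsCountablyGenerated] {β : ℝ} (p b : ℝ) {G : ι → ℝ → ℝ} (hβ : β ∈ Ioo (0 : ℝ) 1)
    (hr : 1 - β < r) (hG : ∀ i, HolderWith C r (G i))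
    (hlim : ∀ y, Tendsto (fun i => G i y) l (𝓝 (g y))) :
    Tendsto (fun i => ∫ x in Ioo p b, (x - p) ^ (-β) *
        rightFracDeriv (1 - β) b (fun y => G i y - G i b) x) l
      (𝓝 (∫ x in Ioo p b, (x - p) ^ (-β) * rightFracDeriv (1 - β) b (fun y => g y - g b) x)) := by
  have hr0 : 0 < r := NNReal.coe_pos.1 ((sub_pos.2 hβ.2).trans hr)
  set K : ℝ≥0∞ := ENNReal.ofReal
    (C * (b - p) ^ (r - (1 - β)) + C * ((b - p) ^ (r - (1 - β)) / (r - (1 - β))))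
  have hΛ (i : ι) : fracLambda β p b (G i) ≤ K := fracLambda_le_of_holderWith (hG i) hr
  have hΛ_top (i : ι) : fracLambda β p b (G i) < ∞ := fracLambda_lt_top_of_holderWith (hG i) hr
  have hker := integrableOn_sub_rpow_neg hβ.2 p b
  refine tendsto_integral_filter_of_dominated_convergence
    (fun x => (x - p) ^ (-β) * (1 / Real.Gamma β * K.toReal))
    (.of_forall fun i => (integrableOn_mul_rightFracDeriv hker hβ (hΛ_top i)).aestronglyMeasurable)
    (.of_forall fun i => ?_) (hker.mul_const _) ?_
  · filter_upwards [self_mem_ae_restrict measurableSet_Ioo] with x hx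
    have hpos := Real.rpow_nonneg (sub_pos.2 hx.1).le (-β)
    rw [norm_mul, Real.norm_of_nonneg hpos]
    refine mul_le_mul_of_nonneg_left
      ((norm_rightFracDeriv_le hβ (hΛ_top i) (Ioo_subset_Ico_self hx)).trans ?_) hpos
    exact mul_le_mul_of_nonneg_left (ENNReal.toReal_mono ENNReal.ofReal_ne_top (hΛ i))
      (one_div_nonneg.2 (Real.Gamma_pos_of_pos hβ.1).le)
  · filter_upwards [self_mem_ae_restrict measurableSet_Ioo] with x hx
    exact (tendsto_rightFracDeriv hr0 hr hx.2 hG hlim).const_mul _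

theorem integral_kernel_mul_rightFracDeriv {β p b : ℝ} (hβ : β ∈ Ioo (0 : ℝ) 1)
    (hg : HolderWith C r g) (hr : 1 - β < r) (hpb : p ≤ b) :
    ∫ x in Ioo p b, (x - p) ^ (-β) * rightFracDeriv (1 - β) b (fun y => g y - g b) x =
      -(Real.Gamma (1 - β) * (g b - g p)) := by
  have hr0 : 0 < r := NNReal.coe_pos.1 ((sub_pos.2 hβ.2).trans hr)
  have hgc := hg.continuous hr0
  have hsmooth : ∀ᶠ h in 𝓝[≠] (0 : ℝ), -(Real.Gamma (1 - β) *
      (steklovMean h g b - steklovMean h g p)) = ∫ x in Ioo p b, (x - p) ^ (-β) *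
        rightFracDeriv (1 - β) b (fun y => steklovMean h g y - steklovMean h g b) x := by
    filter_upwards [self_mem_nhdsWithin] with h hh
    exact (integral_kernel_mul_rightFracDeriv_of_hasDerivAt hβ hpb
      (hasDerivAt_steklovMean hh hgc) (by fun_prop)).symm
  exact tendsto_nhds_unique (tendsto_integral_kernel_mul_rightFracDeriv p b hβ hr
    (holderWith_steklovMean hr0 hg) (tendsto_steklovMean hgc))
    ((((tendsto_steklovMean hgc b).sub (tendsto_steklovMean hgc p)).const_mul _).neg.congr' hsmooth)

end HolderIntegrator

section StepIntegrand

/-- The unit step at `p`, from which the indicators of the intervals `[p, q)` are built. -/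
noncomputable def unitStep (p : ℝ) : ℝ → ℝ :=
  (Ici p).indicator 1

theorem unitStep_of_le {p x : ℝ} (h : p ≤ x) : unitStep p x = 1 :=
  indicator_of_mem (mem_Ici.2 h) 1

theorem unitStep_of_lt {p x : ℝ} (h : x < p) : unitStep p x = 0 :=
  indicator_of_notMem (by simpa using h) 1

@[fun_prop]
theorem measurable_unitStep (p : ℝ) : Measurable (unitStep p) :=
  measurable_one.indicator measurableSet_Ici

theorem indicator_Ico_eq_unitStep {p q : ℝ} (hpq : p ≤ q) :
    (Ico p q).indicator 1 = unitStep p + fun x => (-1) * unitStep q x := by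
  ext x
  rcases lt_or_ge x p with hxp | hpx
  · simp [unitStep_of_lt hxp, unitStep_of_lt (hxp.trans_le hpq), hxp.not_ge]
  rcases lt_or_ge x q with hxq | hqx
  · simp [unitStep_of_le hpx, unitStep_of_lt hxq, hpx, hxq]
  · simp [unitStep_of_le hpx, unitStep_of_le hqx, hqx.not_gt]

variable {β a b p x : ℝ}

theorem unitStep_sub_div_rpow (β : ℝ) (hpx : p < x) :
    (fun u => (unitStep p x - unitStep p u) / (x - u) ^ (β + 1)) =
      (Iio p).indicator fun u => (x - u) ^ (-(β + 1)) := by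
  ext u
  rcases lt_or_ge u p with hup | hpu
  · rw [unitStep_of_le hpx.le, unitStep_of_lt hup, sub_zero, indicator_of_mem (mem_Iio.2 hup),
      Real.rpow_neg (sub_pos.2 (hup.trans hpx)).le, one_div]
  · rw [unitStep_of_le hpx.le, unitStep_of_le hpu, sub_self, zero_div,
      indicator_of_notMem (by simpa using hpu)]

theorem integrableOn_unitStep_sub_div_rpow (β a : ℝ) (hpx : p < x) :
    IntegrableOn (fun u => (unitStep p x - unitStep p u) / (x - u) ^ (β + 1)) (Ioo a x) := by
  rw [unitStep_sub_div_rpow β hpx]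
  have hcont : ContinuousOn (fun u => (x - u) ^ (-(β + 1))) (Icc a p) :=
    ContinuousOn.rpow_const (by fun_prop) fun u hu => Or.inl (sub_pos.2 (hu.2.trans_lt hpx)).ne'
  refine IntegrableOn.integrable_indicator ?_ measurableSet_Iio |>.mono_measure le_rfl
  rw [IntegrableOn, Measure.restrict_restrict measurableSet_Iio]
  exact hcont.integrableOn_Icc.mono_set fun u hu => ⟨hu.2.1.le, hu.1.le⟩

theorem integral_unitStep_sub_div_rpow (hβ : β ≠ 0) (hap : a ≤ p) (hpx : p < x) :
    ∫ u in Ioo a x, (unitStep p x - unitStep p u) / (x - u) ^ (β + 1) =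
      ((x - p) ^ (-β) - (x - a) ^ (-β)) / β := by
  have hzero : (0 : ℝ) ∉ uIcc (x - p) (x - a) := by
    rw [uIcc_of_le (by linarith)]
    exact fun h => (sub_pos.2 hpx).not_ge h.1
  rw [unitStep_sub_div_rpow β hpx, setIntegral_indicator measurableSet_Iio, Ioo_inter_Iio,
    min_eq_right hpx.le, ← integral_Ioc_eq_integral_Ioo, ← intervalIntegral.integral_of_le hap,
    intervalIntegral.integral_comp_sub_left (· ^ (-(β + 1))),
    integral_rpow (Or.inr ⟨by contrapose! hβ; linarith, hzero⟩)]
  rw [neg_add, neg_add_cancel_right, div_neg, ← neg_div, neg_sub]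

theorem leftFracDeriv_unitStep (hβ : β ≠ 0) (hap : a ≤ p) (hpx : p < x) :
    leftFracDeriv β a (unitStep p) x = 1 / Real.Gamma (1 - β) * (x - p) ^ (-β) := by
  rw [leftFracDeriv, intervalIntegral.integral_of_le (hap.trans hpx.le),
    integral_Ioc_eq_integral_Ioo, integral_unitStep_sub_div_rpow hβ hap hpx,
    unitStep_of_le hpx.le, mul_div_cancel₀ _ hβ, Real.rpow_neg (x := x - a) (by linarith),
    ← one_div ((x - a) ^ β), add_sub_cancel]

theorem leftFracDeriv_unitStep_of_lt (β : ℝ) (hax : a ≤ x) (hxp : x < p) :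
    leftFracDeriv β a (unitStep p) x = 0 := by
  have hzero : ∀ u ∈ uIcc a x, (unitStep p x - unitStep p u) / (x - u) ^ (β + 1) = 0 := by
    intro u hu
    rw [uIcc_of_le hax] at hu
    rw [unitStep_of_lt hxp, unitStep_of_lt (hu.2.trans_lt hxp), sub_zero, zero_div]
  rw [leftFracDeriv, intervalIntegral.integral_congr hzero, unitStep_of_lt hxp]
  simp

theorem lintegral_abs_unitStep_sub_div_rpow (hβ : β ≠ 0) (hap : a ≤ p) (hpx : p < x) :
    ∫⁻ u in Ioo a x, ENNReal.ofReal (|unitStep p x - unitStep p u| / (x - u) ^ (β + 1)) =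
      ENNReal.ofReal (((x - p) ^ (-β) - (x - a) ^ (-β)) / β) := by
  have hnonneg (u : ℝ) : 0 ≤ unitStep p x - unitStep p u := by
    rcases lt_or_ge u p with hup | hpu
    · simp [unitStep_of_le hpx.le, unitStep_of_lt hup]
    · simp [unitStep_of_le hpx.le, unitStep_of_le hpu]
  simp only [abs_of_nonneg (hnonneg _)]
  rw [← integral_unitStep_sub_div_rpow hβ hap hpx,
    ofReal_integral_eq_lintegral_ofReal (integrableOn_unitStep_sub_div_rpow β a hpx)]
  filter_upwards [self_mem_ae_restrict measurableSet_Ioo] with u hu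
  exact div_nonneg (hnonneg u) (Real.rpow_nonneg (sub_pos.2 hu.2).le _)

theorem fracNorm_unitStep_lt_top (hβ : β ∈ Ioo (0 : ℝ) 1) (hap : a ≤ p) (b : ℝ) :
    fracNorm β a b (unitStep p) < ∞ := by
  have hpow (c d : ℝ) : IntegrableOn (fun t => (t - c) ^ (-β)) (Ioo c d) :=
    integrableOn_sub_rpow_neg hβ.2 c d
  have hbound : IntegrableOn (fun t => (Ioi p).indicator
      (fun t => (t - a) ^ (-β) + ((t - p) ^ (-β) - (t - a) ^ (-β)) / β) t) (Ioo a b) := by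
    refine IntegrableOn.integrable_indicator ?_ measurableSet_Ioi
    rw [IntegrableOn, Measure.restrict_restrict measurableSet_Ioi]
    have ha := (hpow a b).mono_set (s := Ioi p ∩ Ioo a b) inter_subset_right
    have hp := (hpow p b).mono_set (s := Ioi p ∩ Ioo a b) fun t ht => ⟨ht.1, ht.2.2⟩
    exact ha.add ((hp.sub ha).div_const β)
  refine (lintegral_mono_ae ?_).trans_lt hbound.lintegral_lt_top
  filter_upwards [self_mem_ae_restrict measurableSet_Ioo, Measure.ae_ne _ p] with t ht htp
  rcases lt_or_gt_of_ne htp with hlt | hgt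
  · rw [unitStep_of_lt hlt, setLIntegral_congr_fun (g := 0) measurableSet_Ioo fun s hs => by
      simp [unitStep_of_lt (hs.2.trans hlt)]]
    simp
  · have hle : (t - a) ^ (-β) ≤ (t - p) ^ (-β) :=
      Real.rpow_le_rpow_of_nonpos (sub_pos.2 hgt) (by linarith) (by linarith [hβ.1])
    rw [lintegral_abs_unitStep_sub_div_rpow hβ.1.ne' hap hgt, unitStep_of_le hgt.le,
      indicator_of_mem (mem_Ioi.2 hgt), abs_one, one_div, ← Real.rpow_neg (sub_pos.2 ht.1).le,
      ← ENNReal.ofReal_add (Real.rpow_nonneg (sub_pos.2 ht.1).le _)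
        (div_nonneg (sub_nonneg.2 hle) hβ.1.le)]

theorem glsIntegrable_unitStep {g : ℝ → ℝ} (hβ : β ∈ Ioo (0 : ℝ) 1)
    (hg : fracLambda β a b g < ∞) (hap : a ≤ p) : GLSIntegrable β a b (unitStep p) g where
  order_pos := hβ.1
  order_lt_one := hβ.2
  aemeasurable := (measurable_unitStep p).aemeasurable
  fracNorm_lt_top := fracNorm_unitStep_lt_top hβ hap b
  fracLambda_lt_top := hg

variable {C r : ℝ≥0} {g : ℝ → ℝ}

theorem glsIntegral_unitStep (hβ : β ∈ Ioo (0 : ℝ) 1) (hg : HolderWith C r g) (hr : 1 - β < r)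
    (hap : a ≤ p) (hab : a ≤ b) : glsIntegral β a b (unitStep p) g = g b - g (min p b) := by
  have hmul : ∀ᵐ x ∂volume.restrict (Ioo a b),
      leftFracDeriv β a (unitStep p) x * rightFracDeriv (1 - β) b (fun y => g y - g b) x =
        (Ioi p).indicator (fun x => 1 / Real.Gamma (1 - β) *
          ((x - p) ^ (-β) * rightFracDeriv (1 - β) b (fun y => g y - g b) x)) x := by
    filter_upwards [self_mem_ae_restrict measurableSet_Ioo, Measure.ae_ne _ p] with x hx hxp
    rcases lt_or_gt_of_ne hxp with hlt | hgt
    · rw [leftFracDeriv_unitStep_of_lt β hx.1.le hlt, zero_mul,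
        indicator_of_notMem (by simpa using hlt.le)]
    · rw [leftFracDeriv_unitStep hβ.1.ne' hap hgt, indicator_of_mem (mem_Ioi.2 hgt), mul_assoc]
  rw [glsIntegral_eq_neg_setIntegral hab, integral_congr_ae hmul,
    setIntegral_indicator measurableSet_Ioi, Ioo_inter_Ioi, max_eq_right hap, integral_const_mul]
  rcases le_total p b with hpb | hbp
  · have hΓ := (Real.Gamma_pos_of_pos (sub_pos.2 hβ.2)).ne'
    rw [integral_kernel_mul_rightFracDeriv hβ hg hr hpb, min_eq_left hpb]
    field_simp
  · simp [Ioo_eq_empty_of_le hbp, min_eq_right hbp]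

theorem glsIntegrable_indicator_Ico {q : ℝ} (hβ : β ∈ Ioo (0 : ℝ) 1)
    (hg : fracLambda β a b g < ∞) (hap : a ≤ p) (hpq : p ≤ q) :
    GLSIntegrable β a b ((Ico p q).indicator 1) g := by
  rw [indicator_Ico_eq_unitStep hpq]
  exact (glsIntegrable_unitStep hβ hg hap).add
    ((glsIntegrable_unitStep hβ hg (hap.trans hpq)).const_mul _)

theorem glsIntegral_indicator_Ico {q : ℝ} (hβ : β ∈ Ioo (0 : ℝ) 1) (hg : HolderWith C r g)
    (hr : 1 - β < r) (hap : a ≤ p) (hpq : p ≤ q) (hab : a ≤ b) :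
    glsIntegral β a b ((Ico p q).indicator 1) g = g (min q b) - g (min p b) := by
  have hΛ := fracLambda_lt_top_of_holderWith (a := a) (b := b) hg hr
  have haq := hap.trans hpq
  rw [indicator_Ico_eq_unitStep hpq, glsIntegral_add hab (glsIntegrable_unitStep hβ hΛ hap)
    ((glsIntegrable_unitStep hβ hΛ haq).const_mul _), glsIntegral_const_mul,
    glsIntegral_unitStep hβ hg hr hap hab, glsIntegral_unitStep hβ hg hr haq hab]
  ring

end StepIntegrand

section StoppedGain

variable {ε κ : ℝ} {y z : ℕ → ℝ} {k n N : ℕ}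

open Classical in
/-- The integrand `2 y`, switched off once the sequence `y` has left the interval `(-ε, ε)`. -/
noncomputable def stoppedCoeff (ε : ℝ) (y : ℕ → ℝ) (k : ℕ) : ℝ :=
  if ∀ j ≤ k, |y j| < ε then 2 * y k else 0

/-- The Riemann sum of the stopped integrand `2 y` against `y`: up to the quadratic variation of `y`
it is the square of `y` at the exit from `(-ε, ε)`. -/
noncomputable def stoppedGain (ε : ℝ) (y : ℕ → ℝ) (n : ℕ) : ℝ :=
  ∑ k ∈ Finset.range n, stoppedCoeff ε y k * (y (k + 1) - y k)

theorem stoppedGain_succ (ε : ℝ) (y : ℕ → ℝ) (n : ℕ) :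
    stoppedGain ε y (n + 1) = stoppedGain ε y n + stoppedCoeff ε y n * (y (n + 1) - y n) :=
  Finset.sum_range_succ _ _

theorem stoppedCoeff_congr (h : ∀ j ≤ k, y j = z j) : stoppedCoeff ε y k = stoppedCoeff ε z k := by
  have hiff : (∀ j ≤ k, |y j| < ε) ↔ ∀ j ≤ k, |z j| < ε :=
    forall₂_congr fun j hj => by rw [h j hj]
  simp only [stoppedCoeff, hiff, h k le_rfl]

theorem stoppedGain_congr (h : ∀ j ≤ n, y j = z j) : stoppedGain ε y n = stoppedGain ε z n :=
  Finset.sum_congr rfl fun k hk => by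
    have hkn : k < n := Finset.mem_range.1 hk
    rw [stoppedCoeff_congr fun j hj => h j (hj.trans hkn.le), h k hkn.le, h (k + 1) hkn]

theorem stoppedGain_eq_sq_sub_sum (h0 : y 0 = 0) (hy : ∀ j < n, |y j| < ε) :
    stoppedGain ε y n = y n ^ 2 - ∑ k ∈ Finset.range n, (y (k + 1) - y k) ^ 2 := by
  induction n with
  | zero => simp [stoppedGain, h0]
  | succ n ih =>
    have hcoeff : stoppedCoeff ε y n = 2 * y n := if_pos fun j hj => hy j (Nat.lt_succ_of_le hj)
    rw [stoppedGain_succ, ih fun j hj => hy j (hj.trans n.lt_succ_self), Finset.sum_range_succ,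
      hcoeff]
    ring

theorem exists_stoppedGain_eq_of_exit (ε : ℝ) (y : ℕ → ℝ) (N : ℕ) :
    ∃ K ≤ N, (∀ j < K, |y j| < ε) ∧ (K = N ∨ ε ≤ |y K|) ∧
      stoppedGain ε y N = stoppedGain ε y K := by
  induction N with
  | zero => exact ⟨0, le_rfl, by simp, Or.inl rfl, rfl⟩
  | succ N ih =>
    obtain ⟨K, hKN, hin, hcase, hgain⟩ := ih
    by_cases hexit : ε ≤ |y K|
    · have hcoeff : stoppedCoeff ε y N = 0 := if_neg fun h => (h K hKN).not_ge hexit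
      exact ⟨K, hKN.trans N.le_succ, hin, Or.inr hexit,
        by rw [stoppedGain_succ, hcoeff, zero_mul, add_zero, hgain]⟩
    · obtain rfl : K = N := hcase.resolve_right hexit
      exact ⟨K + 1, le_rfl, Nat.forall_lt_succ_right.2 ⟨hin, not_le.1 hexit⟩, Or.inl rfl, rfl⟩

theorem sum_sq_sub_le (hy : ∀ k < N, |y (k + 1) - y k| ≤ κ) :
    ∑ k ∈ Finset.range N, (y (k + 1) - y k) ^ 2 ≤ N * κ ^ 2 := by
  refine (Finset.sum_le_card_nsmul _ _ (κ ^ 2) fun k hk => ?_).trans_eq (by simp)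
  rw [← sq_abs]
  exact pow_le_pow_left₀ (abs_nonneg _) (hy k (Finset.mem_range.1 hk)) 2

theorem abs_le_add_of_forall_lt (hε : 0 ≤ ε) (hκ : 0 ≤ κ) (h0 : y 0 = 0)
    (hstep : ∀ k < N, |y (k + 1) - y k| ≤ κ) (hy : ∀ k < N, |y k| < ε) : |y N| ≤ ε + κ := by
  rcases N with _ | k
  · rw [h0, abs_zero]
    positivity
  · calc |y (k + 1)| = |y k + (y (k + 1) - y k)| := by rw [add_sub_cancel]
      _ ≤ |y k| + |y (k + 1) - y k| := abs_add_le _ _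
      _ ≤ ε + κ := add_le_add (hy k k.lt_succ_self).le (hstep k k.lt_succ_self)

theorem exists_abs_stoppedGain_sub_sq_le (hε : 0 ≤ ε) (hκ : 0 ≤ κ) (h0 : y 0 = 0)
    (hy : ∀ k < N, |y (k + 1) - y k| ≤ κ) :
    ∃ K ≤ N, |y K| ≤ ε + κ ∧ (∀ j < K, |y j| < ε) ∧ (K = N ∨ ε ≤ |y K|) ∧
      stoppedGain ε y N ∈ Icc (y K ^ 2 - N * κ ^ 2) (y K ^ 2) := by
  obtain ⟨K, hKN, hin, hcase, hgain⟩ := exists_stoppedGain_eq_of_exit ε y N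
  have hyK : ∀ k < K, |y (k + 1) - y k| ≤ κ := fun k hk => hy k (hk.trans_le hKN)
  refine ⟨K, hKN, abs_le_add_of_forall_lt hε hκ h0 hyK hin, hin, hcase, ?_⟩
  rw [hgain, stoppedGain_eq_sq_sub_sum h0 hin]
  have hqv : ∑ k ∈ Finset.range K, (y (k + 1) - y k) ^ 2 ≤ N * κ ^ 2 :=
    (sum_sq_sub_le hyK).trans (by gcongr)
  exact ⟨by linarith, sub_le_self _ (Finset.sum_nonneg fun _ _ => sq_nonneg _)⟩

theorem abs_stoppedGain_le (hε : 0 ≤ ε) (hκ : 0 ≤ κ) (h0 : y 0 = 0)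
    (hy : ∀ k < N, |y (k + 1) - y k| ≤ κ) (hfine : 2 * ε * κ + (N + 1) * κ ^ 2 ≤ ε ^ 2 / 2) :
    |stoppedGain ε y N| ≤ 2 * ε ^ 2 := by
  obtain ⟨K, -, hyK, -, -, hlower, hupper⟩ := exists_abs_stoppedGain_sub_sq_le hε hκ h0 hy
  have hsq : y K ^ 2 ≤ (ε + κ) ^ 2 := sq_le_sq' (abs_le.1 hyK).1 (abs_le.1 hyK).2
  have : 0 ≤ (N : ℝ) * κ ^ 2 := by positivity
  rw [abs_le]
  constructor <;> nlinarith [sq_nonneg (y K), sq_nonneg κ, mul_nonneg hε hκ]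

theorem abs_stoppedGain_sub_sq_le (hε : 0 ≤ ε) (hκ : 0 ≤ κ) (h0 : y 0 = 0)
    (hy : ∀ k < N, |y (k + 1) - y k| ≤ κ) (hfine : 2 * ε * κ + (N + 1) * κ ^ 2 ≤ ε ^ 2 / 2)
    (hexit : ∃ k ≤ N, ε ≤ |y k|) : |stoppedGain ε y N - ε ^ 2| ≤ ε ^ 2 / 2 := by
  obtain ⟨K, -, hyK, hin, hcase, hlower, hupper⟩ := exists_abs_stoppedGain_sub_sq_le hε hκ h0 hy
  obtain ⟨k, hkN, hk⟩ := hexit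
  have hKexit : ε ≤ |y K| := by
    rcases hcase with rfl | hK
    · rcases hkN.eq_or_lt with rfl | hlt
      · exact hk
      · exact absurd hk (hin k hlt).not_ge
    · exact hK
  have hsq_lower : ε ^ 2 ≤ y K ^ 2 := sq_le_sq.2 (by rwa [abs_of_nonneg hε])
  have hsq : y K ^ 2 ≤ (ε + κ) ^ 2 := sq_le_sq' (abs_le.1 hyK).1 (abs_le.1 hyK).2
  have : 0 ≤ (N : ℝ) * κ ^ 2 := by positivity
  rw [abs_le]
  constructor <;> nlinarith [sq_nonneg κ, mul_nonneg hε hκ]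

end StoppedGain

section Relaxation

theorem tendsto_zero_of_le_mul_add {e r : ℕ → ℝ} {q : ℝ} (he : ∀ n, 0 ≤ e n) (hq₀ : 0 ≤ q)
    (hq₁ : q < 1) (hr : Tendsto r atTop (𝓝 0))
    (h : ∀ᶠ n in atTop, e (n + 1) ≤ q * e n + r n) : Tendsto e atTop (𝓝 0) := by
  refine tendsto_order.2 ⟨fun b hb => .of_forall fun n => hb.trans_le (he n), fun b hb => ?_⟩
  have hb' : 0 < (1 - q) * (b / 2) := mul_pos (sub_pos.2 hq₁) (half_pos hb)
  obtain ⟨n₀, hn₀⟩ := eventually_atTop.1 (h.and (hr.eventually_lt_const hb'))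
  have hgeom (k : ℕ) : e (k + n₀) ≤ b / 2 + q ^ k * e n₀ := by
    induction k with
    | zero => simpa using (half_pos hb).le
    | succ k ih =>
      obtain ⟨hstep, hsmall⟩ := hn₀ (k + n₀) (Nat.le_add_left _ _)
      have hmul := mul_le_mul_of_nonneg_left ih hq₀
      rw [Nat.succ_add, pow_succ']
      linarith
  have hlim : Tendsto (fun k => b / 2 + q ^ k * e n₀) atTop (𝓝 (b / 2 + 0 * e n₀)) :=
    ((tendsto_pow_atTop_nhds_zero_of_lt_one hq₀ hq₁).mul_const _).const_add _
  rw [← map_add_atTop_eq_nat n₀, eventually_map]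
  filter_upwards [(tendsto_order.1 hlim).2 b (by linarith)] with k hk
  exact (hgeom k).trans_lt hk

theorem tendsto_of_relaxation {w η G : ℕ → ℝ} {q ξ : ℝ} (hq : q < 1)
    (hw : ∀ n, w (n + 1) = w n + (η n - w n) * G n) (hG : ∀ᶠ n in atTop, |G n - 1| ≤ q)
    (hη : Tendsto η atTop (𝓝 ξ)) : Tendsto w atTop (𝓝 ξ) := by
  have hq₀ : 0 ≤ q := hG.exists.elim fun n hn => (abs_nonneg _).trans hn
  rw [tendsto_iff_dist_tendsto_zero] at hη ⊢
  refine tendsto_zero_of_le_mul_add (fun _ => dist_nonneg) hq₀ hq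
    (r := fun n => (1 + q) * dist (η n) ξ) (by simpa using hη.const_mul (1 + q)) ?_
  filter_upwards [hG] with n hn
  have hGn : |G n| ≤ 1 + q := by
    calc |G n| = |1 + (G n - 1)| := by rw [add_sub_cancel]
      _ ≤ 1 + |G n - 1| := (abs_add_le _ _).trans_eq (by rw [abs_one])
      _ ≤ 1 + q := by gcongr
  simp only [Real.dist_eq]
  calc |w (n + 1) - ξ| = |-(G n - 1) * (w n - ξ) + G n * (η n - ξ)| := by
        rw [hw]
        ring_nf
    _ ≤ |G n - 1| * |w n - ξ| + |G n| * |η n - ξ| := by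
        simpa only [abs_mul, abs_neg] using abs_add_le (-(G n - 1) * (w n - ξ)) (G n * (η n - ξ))
    _ ≤ q * |w n - ξ| + (1 + q) * |η n - ξ| := by gcongr

end Relaxation

section StoppedPath

/-- The path `x` stopped at time `t`. -/
def stoppedPath (t : ℝ) (x : ℝ → ℝ) (u : ℝ) : ℝ :=
  x (min u t)

theorem stoppedPath_of_le {t u : ℝ} (x : ℝ → ℝ) (h : u ≤ t) : stoppedPath t x u = x u := by
  rw [stoppedPath, min_eq_left h]

theorem holderWith_stoppedPath {C r : ℝ≥0} {x : ℝ → ℝ} (hx : HolderWith C r x) (t : ℝ) :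
    HolderWith C r (stoppedPath t x) := by
  refine holderOnWith_univ.1 (holderOnWith_of_forall_lt fun u _ v _ huv => ?_)
  have hlip : |min v t - min u t| ≤ v - u := by
    rw [← abs_of_pos (sub_pos.2 huv)]
    exact (LipschitzWith.id.min_const t).dist_le_mul v u |>.trans_eq (one_mul _)
  exact (abs_sub_le_of_holderWith hx _ _).trans (by gcongr)

end StoppedPath

/-- The blocks `[time n, time (n + 1)]` into which a trading strategy on `[0, 1)` divides its
activity, the number `size n` of equidistant trades in the `n`-th block, and the `level n` at which
trading stops in it. -/
structure TradingSchedule where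
  time : ℕ → I
  monotone_time : Monotone time
  time_zero : time 0 = 0
  time_lt_one : ∀ n, time n < 1
  tendsto_time : Tendsto time atTop (𝓝 1)
  size : ℕ → ℕ
  size_pos : ∀ n, 0 < size n
  level : ℕ → ℝ
  level_pos : ∀ n, 0 < level n

namespace TradingSchedule

variable (S : TradingSchedule)

/-- The distance of two consecutive trades in the `n`-th block. -/
noncomputable def mesh (n : ℕ) : ℝ :=
  (S.time (n + 1) - S.time n) / S.size n

/-- The time of the `k`-th trade in the `n`-th block. -/
noncomputable def node (n k : ℕ) : ℝ :=
  S.time n + k * S.mesh n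

/-- The change of the path `x` from the beginning of the `n`-th block to the `k`-th trade. -/
noncomputable def increment (x : ℝ → ℝ) (n k : ℕ) : ℝ :=
  x (S.node n k) - x (S.time n)

/-- The gain of the `n`-th block per unit of capital, normalised so that it is close to `1` if the
path reaches the stopping level along a fine grid. -/
noncomputable def gain (x : ℝ → ℝ) (n : ℕ) : ℝ :=
  stoppedGain (S.level n) (S.increment x n) (S.size n) / S.level n ^ 2

/-- The capital at `time n` of the strategy which in the `j`-th block aims at the target `η j`: it
stakes the difference between target and capital. -/
noncomputable def wealth (η : ℕ → ℝ) (x : ℝ → ℝ) : ℕ → ℝ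
  | 0 => 0
  | n + 1 => wealth η x n + (η n - wealth η x n) * S.gain x n

/-- The step function whose integral against `x` over the `n`-th block is `S.gain x n`. -/
noncomputable def blockIntegrand (x : ℝ → ℝ) (n : ℕ) : ℝ → ℝ :=
  ∑ k ∈ Finset.range (S.size n), fun u =>
    stoppedCoeff (S.level n) (S.increment x n) k / S.level n ^ 2 *
      (Ico (S.node n k) (S.node n (k + 1))).indicator 1 u

/-- The strategy with targets `η`, whose integral over `[0, time n]` against `x` is
`S.wealth η x n`. -/
noncomputable def integrand (η : ℕ → ℝ) (x : ℝ → ℝ) (u : ℝ) : ℝ :=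
  ∑' n, (η n - S.wealth η x n) * S.blockIntegrand x n u

/-- A bound for the oscillation over one mesh width in the `n`-th block of all paths with Hölder
exponent `r` and Hölder constant at most `n`. Every Hölder path is covered from some block on. -/
noncomputable def modulus (r : ℝ) (n : ℕ) : ℝ :=
  n * S.mesh n ^ r

/-- The grids are so fine that for a path with Hölder exponent `r` both the overshoot over the
stopping level and the quadratic variation along the grid are eventually negligible. -/
def IsFine (r : ℝ) : Prop :=
  ∀ n, 2 * S.level n * S.modulus r n + (S.size n + 1) * S.modulus r n ^ 2 ≤ S.level n ^ 2 / 2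

/-- The path `x` leaves the interval of radius `2 * S.level n` around its starting point in the
`n`-th block. -/
def Exits (x : ℝ → ℝ) (n : ℕ) : Prop :=
  ∃ u ∈ Icc (S.time n : ℝ) (S.time (n + 1)), 2 * S.level n < |x u - x (S.time n)|

section Grid

theorem time_le_time {m n : ℕ} (h : m ≤ n) : (S.time m : ℝ) ≤ S.time n :=
  S.monotone_time h

theorem mesh_nonneg (n : ℕ) : 0 ≤ S.mesh n :=
  div_nonneg (sub_nonneg.2 (S.time_le_time n.le_succ)) (Nat.cast_nonneg _)

theorem node_zero (n : ℕ) : S.node n 0 = S.time n := by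
  simp [node]

theorem node_size (n : ℕ) : S.node n (S.size n) = S.time (n + 1) := by
  have hsize : (S.size n : ℝ) ≠ 0 := Nat.cast_ne_zero.2 (S.size_pos n).ne'
  rw [node, mesh, mul_div_cancel₀ _ hsize, add_sub_cancel]

theorem node_succ_sub_node (n k : ℕ) : S.node n (k + 1) - S.node n k = S.mesh n := by
  simp only [node, Nat.cast_add_one]
  ring

theorem monotone_node (n : ℕ) : Monotone (S.node n) :=
  monotone_nat_of_le_succ fun k =>
    sub_nonneg.1 ((S.mesh_nonneg n).trans_eq (S.node_succ_sub_node n k).symm)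

theorem time_le_node (n k : ℕ) : (S.time n : ℝ) ≤ S.node n k :=
  (S.node_zero n).ge.trans (S.monotone_node n k.zero_le)

theorem node_le_time {n k : ℕ} (hk : k ≤ S.size n) : S.node n k ≤ S.time (n + 1) :=
  (S.monotone_node n hk).trans_eq (S.node_size n)

theorem exists_abs_sub_node_le {n : ℕ} {u : ℝ} (hu : u ∈ Icc (S.time n : ℝ) (S.time (n + 1))) :
    ∃ k ≤ S.size n, |u - S.node n k| ≤ S.mesh n := by
  classical
  have hex : ∃ k, u ≤ S.node n k := ⟨S.size n, hu.2.trans_eq (S.node_size n).symm⟩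
  refine ⟨Nat.find hex, Nat.find_min' hex (hu.2.trans_eq (S.node_size n).symm), ?_⟩
  rw [abs_sub_comm, abs_of_nonneg (sub_nonneg.2 (Nat.find_spec hex))]
  rcases h : Nat.find hex with _ | k
  · rw [node_zero]
    linarith [hu.1, S.mesh_nonneg n]
  · have hk : S.node n k < u := not_le.1 (Nat.find_min hex (h ▸ k.lt_succ_self))
    linarith [S.node_succ_sub_node n k]

theorem tendsto_coe_time : Tendsto (fun n => (S.time n : ℝ)) atTop (𝓝 1) :=
  (continuous_subtype_val.tendsto _).comp S.tendsto_time

theorem exists_mem_Ico_time {t : ℝ} (ht : t ∈ Ico (0 : ℝ) 1) :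
    ∃ n, t ∈ Ico (S.time n : ℝ) (S.time (n + 1)) := by
  classical
  have hex : ∃ n, t < S.time n := (S.tendsto_coe_time.eventually_const_lt ht.2).exists
  rcases h : Nat.find hex with _ | n
  · have := Nat.find_spec hex
    rw [h, S.time_zero] at this
    exact absurd ht.1 this.not_ge
  · exact ⟨n, not_lt.1 (Nat.find_min hex (h ▸ n.lt_succ_self)), h ▸ Nat.find_spec hex⟩

end Grid

variable {S} {C r : ℝ≥0} {x : ℝ → ℝ} {n : ℕ}

section Gain

theorem abs_sub_le_modulus (hx : HolderWith C r x) (hn : C ≤ n) {u v : ℝ}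
    (huv : |u - v| ≤ S.mesh n) : |x u - x v| ≤ S.modulus r n :=
  (abs_sub_le_of_holderWith hx u v).trans <| by
    have hC : (C : ℝ) ≤ n := mod_cast hn
    unfold modulus
    gcongr

theorem modulus_nonneg (S : TradingSchedule) (r : ℝ) (n : ℕ) : 0 ≤ S.modulus r n :=
  mul_nonneg n.cast_nonneg (Real.rpow_nonneg (S.mesh_nonneg n) r)

theorem increment_zero (x : ℝ → ℝ) (n : ℕ) : S.increment x n 0 = 0 := by
  rw [increment, node_zero, sub_self]

theorem abs_increment_succ_sub_le (hx : HolderWith C r x) (hn : C ≤ n) (k : ℕ) :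
    |S.increment x n (k + 1) - S.increment x n k| ≤ S.modulus r n := by
  rw [increment, increment, sub_sub_sub_cancel_right]
  exact abs_sub_le_modulus hx hn
    (by rw [node_succ_sub_node, abs_of_nonneg (S.mesh_nonneg n)])

theorem abs_gain_le (hx : HolderWith C r x) (hfine : S.IsFine r) (hn : C ≤ n) :
    |S.gain x n| ≤ 2 := by
  have hlevel := S.level_pos n
  rw [gain, abs_div, abs_of_pos (pow_pos hlevel 2), div_le_iff₀ (pow_pos hlevel 2)]
  exact abs_stoppedGain_le hlevel.le (S.modulus_nonneg r n) (increment_zero x n)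
    (fun k _ => abs_increment_succ_sub_le hx hn k) (hfine n)

theorem exists_level_le_abs_increment (hx : HolderWith C r x) (hfine : S.IsFine r) (hn : C ≤ n)
    (hexit : S.Exits x n) : ∃ k ≤ S.size n, S.level n ≤ |S.increment x n k| := by
  obtain ⟨u, hu, hfar⟩ := hexit
  obtain ⟨k, hk, hclose⟩ := S.exists_abs_sub_node_le hu
  have hmod : S.modulus r n ≤ S.level n := by
    have : 0 ≤ (S.size n : ℝ) * S.modulus r n ^ 2 := by positivity
    nlinarith [hfine n, S.level_pos n, S.modulus_nonneg r n]
  have htri := abs_sub_le (x u) (x (S.node n k)) (x (S.time n))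
  have hosc := abs_sub_le_modulus hx hn hclose
  exact ⟨k, hk, by unfold increment; linarith⟩

theorem abs_gain_sub_one_le (hx : HolderWith C r x) (hfine : S.IsFine r) (hn : C ≤ n)
    (hexit : S.Exits x n) : |S.gain x n - 1| ≤ 1 / 2 := by
  have hlevel := S.level_pos n
  have hsq := pow_pos hlevel 2
  rw [gain, div_sub_one hsq.ne', abs_div, abs_of_pos hsq, div_le_iff₀ hsq, one_div_mul_eq_div]
  exact abs_stoppedGain_sub_sq_le hlevel.le (S.modulus_nonneg r n) (increment_zero x n)
    (fun k _ => abs_increment_succ_sub_le hx hn k) (hfine n)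
    (exists_level_le_abs_increment hx hfine hn hexit)

theorem gain_stoppedPath_of_le {t : ℝ} (x : ℝ → ℝ) (ht : S.time (n + 1) ≤ t) :
    S.gain (stoppedPath t x) n = S.gain x n := by
  rw [gain, gain, stoppedGain_congr fun k hk => ?_]
  rw [increment, increment, stoppedPath_of_le x ((S.node_le_time hk).trans ht),
    stoppedPath_of_le x ((S.time_le_time n.le_succ).trans ht)]

end Gain

section Integral

variable {η : ℕ → ℝ} {β t ξ : ℝ}

theorem wealth_eq_sum (η : ℕ → ℝ) (x : ℝ → ℝ) (n : ℕ) :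
    S.wealth η x n = ∑ j ∈ Finset.range n, (η j - S.wealth η x j) * S.gain x j := by
  induction n with
  | zero => rfl
  | succ n ih => rw [Finset.sum_range_succ, ← ih, wealth]

theorem blockIntegrand_of_lt {u : ℝ} (hu : u < S.time n) : S.blockIntegrand x n u = 0 := by
  rw [blockIntegrand, Finset.sum_apply]
  refine Finset.sum_eq_zero fun k _ => ?_
  rw [indicator_of_notMem fun h => (hu.trans_le (S.time_le_node n k)).not_ge h.1, mul_zero]

theorem integrand_eq_sum_range {u : ℝ} (hu : u < S.time n) :
    S.integrand η x u =
      (∑ j ∈ Finset.range n, fun u => (η j - S.wealth η x j) * S.blockIntegrand x j u) u := by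
  rw [integrand, Finset.sum_apply]
  refine tsum_eq_sum fun j hj => ?_
  have hnj : n ≤ j := by simpa using hj
  rw [blockIntegrand_of_lt (hu.trans_le (S.time_le_time hnj)), mul_zero]

theorem glsIntegrable_blockIntegrand (hβ : β ∈ Ioo (0 : ℝ) 1) (hg : fracLambda β 0 t x < ∞)
    (n : ℕ) : GLSIntegrable β 0 t (S.blockIntegrand x n) x :=
  .sum hβ hg fun k _ => (glsIntegrable_indicator_Ico hβ hg
    ((S.time n).2.1.trans (S.time_le_node n k)) (S.monotone_node n k.le_succ)).const_mul _

theorem glsIntegrable_integrand (hβ : β ∈ Ioo (0 : ℝ) 1) (hx : HolderWith C r x) (hr : 1 - β < r)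
    (ht : t < 1) : GLSIntegrable β 0 t (S.integrand η x) x := by
  have hg : fracLambda β 0 t x < ∞ := fracLambda_lt_top_of_holderWith hx hr
  obtain ⟨n, hn⟩ := (S.tendsto_coe_time.eventually_const_lt ht).exists
  exact (GLSIntegrable.sum hβ hg fun j _ =>
    (glsIntegrable_blockIntegrand hβ hg j).const_mul _).congr
      fun u hu => (integrand_eq_sum_range (hu.2.trans hn)).symm

theorem glsIntegral_blockIntegrand (hβ : β ∈ Ioo (0 : ℝ) 1) (hx : HolderWith C r x)
    (hr : 1 - β < r) (hn : S.time n ≤ t) :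
    glsIntegral β 0 t (S.blockIntegrand x n) x = S.gain (stoppedPath t x) n := by
  have ht : 0 ≤ t := (S.time n).2.1.trans hn
  have hg : fracLambda β 0 t x < ∞ := fracLambda_lt_top_of_holderWith hx hr
  have hnode (k : ℕ) : 0 ≤ S.node n k := (S.time n).2.1.trans (S.time_le_node n k)
  rw [blockIntegrand, glsIntegral_sum ht fun k _ => (glsIntegrable_indicator_Ico hβ hg (hnode k)
    (S.monotone_node n k.le_succ)).const_mul _, gain, stoppedGain, Finset.sum_div]
  refine Finset.sum_congr rfl fun k _ => ?_
  rw [glsIntegral_const_mul,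
    glsIntegral_indicator_Ico hβ hx hr (hnode k) (S.monotone_node n k.le_succ) ht,
    div_mul_eq_mul_div, increment, increment, sub_sub_sub_cancel_right, stoppedPath, stoppedPath]
  rcases le_total (S.node n k) t with hkt | htk
  · rw [stoppedCoeff_congr fun j hj => ?_]
    rw [increment, increment, stoppedPath_of_le x ((S.monotone_node n hj).trans hkt),
      stoppedPath_of_le x hn]
  · rw [min_eq_right htk, min_eq_right (htk.trans (S.monotone_node n k.le_succ)), sub_self,
      mul_zero, mul_zero]

theorem glsIntegral_integrand (hβ : β ∈ Ioo (0 : ℝ) 1) (hx : HolderWith C r x) (hr : 1 - β < r)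
    (ht : t ∈ Icc (S.time n : ℝ) (S.time (n + 1))) :
    glsIntegral β 0 t (S.integrand η x) x =
      S.wealth η x n + (η n - S.wealth η x n) * S.gain (stoppedPath t x) n := by
  have ht0 : 0 ≤ t := (S.time n).2.1.trans ht.1
  have hg : fracLambda β 0 t x < ∞ := fracLambda_lt_top_of_holderWith hx hr
  have heq : EqOn (S.integrand η x) (∑ j ∈ Finset.range (n + 1), fun u =>
      (η j - S.wealth η x j) * S.blockIntegrand x j u) (Ioo 0 t) :=
    fun u hu => integrand_eq_sum_range (hu.2.trans_le ht.2)
  rw [glsIntegral_congr ht0 heq,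
    glsIntegral_sum ht0 fun j _ => (glsIntegrable_blockIntegrand hβ hg j).const_mul _,
    Finset.sum_range_succ, glsIntegral_const_mul, glsIntegral_blockIntegrand hβ hx hr ht.1,
    add_left_inj, wealth_eq_sum]
  refine Finset.sum_congr rfl fun j hj => ?_
  have hjt : S.time (j + 1) ≤ t := (S.time_le_time (Finset.mem_range.1 hj)).trans ht.1
  rw [glsIntegral_const_mul, glsIntegral_blockIntegrand hβ hx hr
    ((S.time_le_time j.le_succ).trans hjt), gain_stoppedPath_of_le x hjt]

theorem tendsto_nhdsLT_one_of_forall_block {F : ℝ → ℝ} {err : ℕ → ℝ}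
    (herr : Tendsto err atTop (𝓝 0))
    (hF : ∀ᶠ n in atTop, ∀ t ∈ Ico (S.time n : ℝ) (S.time (n + 1)), |F t - ξ| ≤ err n) :
    Tendsto F (𝓝[<] 1) (𝓝 ξ) := by
  refine Metric.tendsto_nhds.2 fun b hb => ?_
  obtain ⟨n₀, hn₀⟩ := eventually_atTop.1 (hF.and (herr.eventually_lt_const hb))
  filter_upwards [Ico_mem_nhdsLT (Subtype.coe_lt_coe.2 (S.time_lt_one n₀))] with t ht
  obtain ⟨n, hn⟩ := S.exists_mem_Ico_time ⟨(S.time n₀).2.1.trans ht.1, ht.2⟩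
  have hn₀n : n₀ ≤ n := by
    by_contra! hlt
    exact (hn.2.trans_le (S.time_le_time hlt)).not_ge ht.1
  exact ((hn₀ n hn₀n).1 t hn).trans_lt (hn₀ n hn₀n).2

theorem tendsto_wealth (hx : HolderWith C r x) (hfine : S.IsFine r)
    (hexit : ∀ᶠ n in atTop, S.Exits x n) (hη : Tendsto η atTop (𝓝 ξ)) :
    Tendsto (S.wealth η x) atTop (𝓝 ξ) := by
  have hgain : ∀ᶠ n in atTop, |S.gain x n - 1| ≤ 1 / 2 := by
    filter_upwards [hexit, tendsto_natCast_atTop_atTop.eventually_ge_atTop C] with n hexit hn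
    exact abs_gain_sub_one_le hx hfine hn hexit
  exact tendsto_of_relaxation (by norm_num) (fun _ => rfl) hgain hη

theorem tendsto_glsIntegral_integrand (hβ : β ∈ Ioo (0 : ℝ) 1) (hx : HolderWith C r x)
    (hr : 1 - β < r) (hfine : S.IsFine r) (hexit : ∀ᶠ n in atTop, S.Exits x n)
    (hη : Tendsto η atTop (𝓝 ξ)) :
    Tendsto (fun t => glsIntegral β 0 t (S.integrand η x) x) (𝓝[<] 1) (𝓝 ξ) := by
  have hw := tendsto_wealth hx hfine hexit hη
  have herr : Tendsto (fun n => |S.wealth η x n - ξ| + |η n - S.wealth η x n| * 2) atTop (𝓝 0) := by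
    simpa using (hw.sub_const ξ).abs.add ((hη.sub hw).abs.mul_const 2)
  refine tendsto_nhdsLT_one_of_forall_block (S := S) herr ?_
  filter_upwards [tendsto_natCast_atTop_atTop.eventually_ge_atTop C] with n hn t ht
  rw [glsIntegral_integrand hβ hx hr (Ico_subset_Icc_self ht), add_sub_right_comm]
  refine (abs_add_le _ _).trans (add_le_add_right ?_ _)
  rw [abs_mul]
  gcongr
  exact abs_gain_le (holderWith_stoppedPath hx t) hfine hn

end Integral

end TradingSchedule

section FineGrid

theorem tendsto_succ_mul_div_rpow_sq {r ℓ : ℝ} (hr : 1 / 2 < r) (hℓ : 0 ≤ ℓ) :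
    Tendsto (fun N : ℕ => ((N : ℝ) + 1) * ((ℓ / N) ^ r) ^ 2) atTop (𝓝 0) := by
  have hpow : Tendsto (fun N : ℕ => (N : ℝ) ^ (-(2 * r - 1))) atTop (𝓝 0) :=
    (tendsto_rpow_neg_atTop (by linarith)).comp tendsto_natCast_atTop_atTop
  have hratio : Tendsto (fun N : ℕ => 1 + 1 / (N : ℝ)) atTop (𝓝 (1 + 0)) :=
    tendsto_one_div_atTop_nhds_zero_nat.const_add 1
  have hlim := (hratio.mul hpow).const_mul (ℓ ^ (r * 2))
  rw [mul_zero, mul_zero] at hlim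
  refine hlim.congr' ?_
  filter_upwards [eventually_gt_atTop 0] with N hN
  have hN' : (0 : ℝ) < N := Nat.cast_pos.2 hN
  have hexp : (N : ℝ) ^ (-(2 * r - 1)) = N / (N : ℝ) ^ (r * 2) := by
    rw [show -(2 * r - 1) = 1 - r * 2 by ring, Real.rpow_sub hN', Real.rpow_one]
  rw [hexp, ← Real.rpow_mul_natCast (by positivity), Nat.cast_ofNat,
    Real.div_rpow hℓ hN'.le]
  field_simp

theorem exists_fine_grid {r ℓ ε : ℝ} (c : ℝ) (hr : 1 / 2 < r) (hℓ : 0 ≤ ℓ) (hε : 0 < ε) :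
    ∃ N : ℕ, 0 < N ∧
      2 * ε * (c * (ℓ / N) ^ r) + ((N : ℝ) + 1) * (c * (ℓ / N) ^ r) ^ 2 ≤ ε ^ 2 / 2 := by
  have hr₀ : 0 < r := by linarith
  have hlin : Tendsto (fun N : ℕ => (ℓ / N) ^ r) atTop (𝓝 0) := by
    simpa only [Real.zero_rpow hr₀.ne'] using
      (tendsto_const_div_atTop_nhds_zero_nat ℓ).rpow_const (p := r) (.inr hr₀.le)
  have hsum := (hlin.const_mul (2 * ε * c)).add
    ((tendsto_succ_mul_div_rpow_sq hr hℓ).const_mul (c ^ 2))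
  rw [mul_zero, mul_zero, add_zero] at hsum
  obtain ⟨N, hN, hsmall⟩ := ((eventually_gt_atTop 0).and
    (hsum.eventually_le_const (half_pos (pow_pos hε 2)))).exists
  exact ⟨N, hN, by linarith⟩

end FineGrid

section ProcessPath

variable {Ω : Type*} {X : I → Ω → ℝ} {ω : Ω}

theorem processPath_coe (X : I → Ω → ℝ) (ω : Ω) (t : I) : processPath X ω t = X t ω :=
  IccExtend_val _ _ t

theorem holderWith_processPath {a C : ℝ} (ha : 0 ≤ a)
    (h : ∀ s t : I, |X t ω - X s ω| ≤ C * |(t : ℝ) - s| ^ a) :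
    HolderWith C.toNNReal a.toNNReal (processPath X ω) := by
  refine holderOnWith_univ.1 (holderOnWith_of_forall_lt fun u _ v _ huv => ?_)
  rw [Real.coe_toNNReal a ha]
  have hproj : |(projIcc (0 : ℝ) 1 zero_le_one v : ℝ) - projIcc 0 1 zero_le_one u| ≤ v - u :=
    (abs_projIcc_sub_projIcc zero_le_one).trans_eq (abs_of_pos (sub_pos.2 huv))
  exact (h _ _).trans (mul_le_mul (Real.le_coe_toNNReal C)
    (Real.rpow_le_rpow (abs_nonneg _) hproj ha) (by positivity) C.toNNReal.2)

theorem measurable_processPath {m : MeasurableSpace Ω} {𝓕 : Filtration I m} (hX : Adapted 𝓕 X)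
    {t : I} {u : ℝ} (hu : u ≤ t) : Measurable[𝓕 t] fun ω => processPath X ω u :=
  (hX (projIcc 0 1 zero_le_one u)).mono
    (𝓕.mono ((monotone_projIcc _ hu).trans_eq (projIcc_val _ t))) le_rfl

end ProcessPath

theorem measurable_stoppedCoeff {Ω : Type*} {m : MeasurableSpace Ω} {y : Ω → ℕ → ℝ} {k : ℕ}
    (ε : ℝ) (hy : ∀ j ≤ k, Measurable fun ω => y ω j) :
    Measurable fun ω => stoppedCoeff ε (y ω) k := by
  unfold stoppedCoeff
  refine Measurable.ite ?_ ((hy k le_rfl).const_mul 2) measurable_const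
  simp only [ofPred_forall]
  exact MeasurableSet.iInter fun j => MeasurableSet.iInter fun hj =>
    measurableSet_lt (hy j hj).abs measurable_const

theorem measurable_stoppedGain {Ω : Type*} {m : MeasurableSpace Ω} {y : Ω → ℕ → ℝ} {n : ℕ}
    (ε : ℝ) (hy : ∀ j ≤ n, Measurable fun ω => y ω j) :
    Measurable fun ω => stoppedGain ε (y ω) n := by
  refine Finset.measurable_fun_sum _ fun k hk => ?_
  have hkn : k < n := Finset.mem_range.1 hk
  exact (measurable_stoppedCoeff ε fun j hj => hy j (hj.trans hkn.le)).mul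
    ((hy (k + 1) hkn).sub (hy k hkn.le))

namespace TradingSchedule

section Adapted

variable {S : TradingSchedule} {Ω : Type*} {m : MeasurableSpace Ω} {𝓕 : Filtration I m}
  {X : I → Ω → ℝ} {η : ℕ → Ω → ℝ} {t : I} {n : ℕ}

theorem measurable_increment (hX : Adapted 𝓕 X) {k : ℕ} (hk : S.node n k ≤ t) :
    Measurable[𝓕 t] fun ω => S.increment (processPath X ω) n k :=
  (measurable_processPath hX hk).sub
    (measurable_processPath hX ((S.time_le_node n k).trans hk))

theorem measurable_gain (hX : Adapted 𝓕 X) (n : ℕ) :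
    Measurable[𝓕 (S.time (n + 1))] fun ω => S.gain (processPath X ω) n :=
  (measurable_stoppedGain (m := 𝓕 (S.time (n + 1))) _ fun _ hj =>
    measurable_increment hX (S.node_le_time hj)).div_const _

theorem measurable_wealth (hX : Adapted 𝓕 X) (hη : ∀ n, Measurable[𝓕 (S.time n)] (η n)) (n : ℕ) :
    Measurable[𝓕 (S.time n)] fun ω => S.wealth (fun j => η j ω) (processPath X ω) n := by
  induction n with
  | zero => exact @measurable_const _ _ _ (_) _
  | succ n ih =>
    have hle : 𝓕 (S.time n) ≤ 𝓕 (S.time (n + 1)) := 𝓕.mono (S.monotone_time n.le_succ)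
    have hw := ih.mono hle le_rfl
    exact hw.add ((((hη n).mono hle le_rfl).sub hw).mul (measurable_gain hX n))

theorem measurable_blockIntegrand (hX : Adapted 𝓕 X) (n : ℕ) (t : I) :
    Measurable[𝓕 t] fun ω => S.blockIntegrand (processPath X ω) n t := by
  simp only [blockIntegrand, Finset.sum_apply]
  refine Finset.measurable_fun_sum _ fun k _ => ?_
  rcases lt_or_ge (t : ℝ) (S.node n k) with ht | ht
  · simp only [indicator_of_notMem (fun h => ht.not_ge h.1 :
      (t : ℝ) ∉ Ico (S.node n k) (S.node n (k + 1))), mul_zero]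
    exact @measurable_const _ _ _ (_) _
  · exact ((measurable_stoppedCoeff (m := 𝓕 t) _ fun _ hj =>
      measurable_increment hX ((S.monotone_node n hj).trans ht)).div_const _).mul_const _

theorem measurable_stake_mul_blockIntegrand (hX : Adapted 𝓕 X)
    (hη : ∀ n, Measurable[𝓕 (S.time n)] (η n)) (n : ℕ) (t : I) :
    Measurable[𝓕 t] fun ω => (η n ω - S.wealth (fun j => η j ω) (processPath X ω) n) *
      S.blockIntegrand (processPath X ω) n t := by
  rcases lt_or_ge t (S.time n) with ht | ht
  · simp only [blockIntegrand_of_lt (Subtype.coe_lt_coe.2 ht), mul_zero]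
    exact @measurable_const _ _ _ (_) _
  · exact ((((hη n).sub (measurable_wealth hX hη n)).mono (𝓕.mono ht) le_rfl)).mul
      (measurable_blockIntegrand hX n t)

theorem blockIntegrand_one (x : ℝ → ℝ) (n : ℕ) : S.blockIntegrand x n 1 = 0 := by
  rw [blockIntegrand, Finset.sum_apply]
  refine Finset.sum_eq_zero fun k hk => ?_
  rw [indicator_of_notMem, mul_zero]
  exact fun h => (h.2.trans_le (S.node_le_time (Finset.mem_range.1 hk))).not_ge (S.time _).2.2

theorem adapted_integrand (hX : Adapted 𝓕 X) (hη : ∀ n, Measurable[𝓕 (S.time n)] (η n)) :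
    Adapted 𝓕 fun t ω => S.integrand (fun j => η j ω) (processPath X ω) t := by
  intro t
  rcases t.2.2.eq_or_lt with ht | ht
  · simp only [integrand, ht, blockIntegrand_one, mul_zero, tsum_zero]
    exact @measurable_const _ _ _ (_) _
  · obtain ⟨n, hn⟩ := (S.tendsto_coe_time.eventually_const_lt ht).exists
    simp only [integrand_eq_sum_range hn, Finset.sum_apply]
    exact Finset.measurable_fun_sum _ fun j _ => measurable_stake_mul_blockIntegrand hX hη j t

end Adapted

end TradingSchedule

section Approximation

theorem measurable_tan : Measurable Real.tan := by
  rw [show Real.tan = fun y => Real.sin y / Real.cos y from funext Real.tan_eq_sin_div_cos]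
  fun_prop

/-- Lévy's upward theorem needs an integrable limit, hence the passage through the bounded
function `arctan`. -/
theorem exists_adapted_tendsto {Ω : Type*} {m : MeasurableSpace Ω} (P : Measure Ω)
    [IsFiniteMeasure P] (𝓖 : Filtration ℕ m) {ξ : Ω → ℝ} (hξ : Measurable[⨆ n, 𝓖 n] ξ) :
    ∃ η : ℕ → Ω → ℝ, Adapted 𝓖 η ∧ ∀ᵐ ω ∂P, Tendsto (fun n => η n ω) atTop (𝓝 (ξ ω)) := by
  have hmeas : Measurable[⨆ n, 𝓖 n] fun ω => Real.arctan (ξ ω) := Real.measurable_arctan.comp hξ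
  have hint : Integrable (fun ω => Real.arctan (ξ ω)) P := by
    refine Integrable.of_bound (hmeas.mono (iSup_le 𝓖.le) le_rfl).aestronglyMeasurable
      (Real.pi / 2) (ae_of_all _ fun ω => abs_le.2 ⟨?_, ?_⟩)
    · exact (Real.neg_pi_div_two_lt_arctan _).le
    · exact (Real.arctan_lt_pi_div_two _).le
  refine ⟨fun n ω => Real.tan ((P[fun ω => Real.arctan (ξ ω) | 𝓖 n]) ω), fun n =>
    measurable_tan.comp (stronglyMeasurable_condExp (m := 𝓖 n)).measurable, ?_⟩
  filter_upwards [hint.tendsto_ae_condExp hmeas.stronglyMeasurable] with ω hω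
  have htan := (Real.continuousAt_tan.2 (Real.cos_arctan_pos (ξ ω)).ne').tendsto.comp hω
  rwa [Real.tan_arctan] at htan

theorem LeftContinuousAtOne.iSup_comp_eq {Ω : Type*} {m : MeasurableSpace Ω} {𝓕 : Filtration I m}
    (hF : LeftContinuousAtOne 𝓕) {τ : ℕ → I} (hτ : Tendsto τ atTop (𝓝 1)) (hτ₁ : ∀ n, τ n < 1) :
    ⨆ n, 𝓕 (τ n) = 𝓕 1 := by
  refine le_antisymm (iSup_le fun n => 𝓕.mono (hτ₁ n).le) (hF.symm.le.trans ?_)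
  refine iSup₂_le fun s hs => ?_
  obtain ⟨n, hn⟩ := (hτ.eventually_const_lt hs).exists
  exact le_iSup_of_le n (𝓕.mono hn.le)

theorem exists_measurable_time_tendsto {Ω : Type*} {m : MeasurableSpace Ω} (P : Measure Ω)
    [IsFiniteMeasure P] {𝓕 : Filtration I m} (hF : LeftContinuousAtOne 𝓕) (S : TradingSchedule)
    {ξ : Ω → ℝ} (hξ : Measurable[𝓕 1] ξ) :
    ∃ η : ℕ → Ω → ℝ, (∀ n, Measurable[𝓕 (S.time n)] (η n)) ∧
      ∀ᵐ ω ∂P, Tendsto (fun n => η n ω) atTop (𝓝 (ξ ω)) :=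
  exists_adapted_tendsto P ⟨fun n => 𝓕 (S.time n), fun _ _ h => 𝓕.mono (S.monotone_time h),
    fun _ => 𝓕.le _⟩ (hξ.mono (hF.iSup_comp_eq S.tendsto_time S.time_lt_one).ge le_rfl)

end Approximation

section Exit

theorem eq_of_forall_abs_sub_le {y z : ℝ} {u : I} {τ : ℕ → I} (hτ : Tendsto τ atTop (𝓝 1))
    (hu : u < 1) (h : ∀ n : ℕ, u < τ n → |y - z| ≤ 2 * (1 / ((n : ℝ) + 1))) : y = z := by
  have hlim : Tendsto (fun n : ℕ => 2 * (1 / ((n : ℝ) + 1))) atTop (𝓝 0) := by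
    simpa only [mul_zero] using (tendsto_one_div_add_atTop_nhds_zero_nat (𝕜 := ℝ)).const_mul 2
  exact eq_of_abs_sub_nonpos (ge_of_tendsto hlim ((hτ.eventually_const_lt hu).mono h))

theorem eventuallyConst_nhdsLT_one_of_dense {x : I → ℝ} (hx : Continuous x) {D : Set I}
    (hD : Dense D) {s : I} (hs : s < 1) (h : ∀ u ∈ D ∩ Ioo s 1, x u = x s) :
    EventuallyConst x (𝓝[<] 1) := by
  refine eventuallyConst_iff_exists_eventuallyEq.2 ⟨x s, ?_⟩
  filter_upwards [Ioo_mem_nhdsLT hs] with u hu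
  have heq : EqOn x (fun _ => x s) (closure (Ioo s 1 ∩ D)) :=
    EqOn.closure (fun v hv => h v hv.symm) hx continuous_const
  exact heq (hD.open_subset_closure_inter isOpen_Ioo hu)

variable {Ω : Type*} [MeasurableSpace Ω] {P : Measure Ω} {X : I → Ω → ℝ}

theorem exists_measure_forall_abs_sub_le [IsFiniteMeasure P] (hXm : ∀ t, Measurable (X t))
    (hcont : ∀ᵐ ω ∂P, Continuous fun t => X t ω)
    (hvary : ∀ᵐ ω ∂P, ¬ EventuallyConst (fun t => X t ω) (𝓝[<] 1)) {s b : I} (hs : s < 1)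
    (hb : b < 1) {q : ℝ≥0∞} (hq : 0 < q) :
    ∃ t, s ≤ t ∧ b ≤ t ∧ t < 1 ∧ ∃ ε > 0,
      P {ω | ∀ u ∈ Icc s t, |X u ω - X s ω| ≤ 2 * ε} ≤ q := by
  obtain ⟨D, hDcount, hDdense⟩ := TopologicalSpace.exists_countable_dense I
  obtain ⟨τ, hτmono, hτmem, hτlim⟩ := exists_seq_strictMono_tendsto' (max_lt hs hb)
  set A : ℕ → Set Ω := fun n =>
    ⋂ u ∈ D ∩ Ioo s (τ n), {ω | |X u ω - X s ω| ≤ 2 * (1 / ((n : ℝ) + 1))} with hA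
  have hAm (n : ℕ) : MeasurableSet (A n) :=
    .biInter (hDcount.mono inter_subset_left) fun u _ =>
      measurableSet_le ((hXm u).sub (hXm s)).abs measurable_const
  have hAanti : Antitone A := fun i j hij ω hω => by
    simp only [hA, mem_iInter₂, mem_ofPred_eq] at hω ⊢
    exact fun u hu => (hω u ⟨hu.1, hu.2.1, hu.2.2.trans_le (hτmono.monotone hij)⟩).trans <|
      mul_le_mul_of_nonneg_left (Nat.one_div_le_one_div hij) zero_le_two
  have hnull : P (⋂ n, A n) = 0 := by
    rw [measure_eq_zero_iff_ae_notMem]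
    filter_upwards [hcont, hvary] with ω hω hωvary hωA
    refine hωvary (eventuallyConst_nhdsLT_one_of_dense hω hDdense hs fun u hu => ?_)
    refine eq_of_forall_abs_sub_le hτlim hu.2.2 fun n hn => ?_
    exact mem_iInter₂.1 (mem_iInter.1 hωA n) u ⟨hu.1, hu.2.1, hn⟩
  have hlim := tendsto_measure_iInter_atTop (fun n => (hAm n).nullMeasurableSet (μ := P)) hAanti
    ⟨0, measure_ne_top P _⟩
  rw [hnull] at hlim
  obtain ⟨n, hn⟩ := (hlim.eventually_le_const hq).exists
  refine ⟨τ n, (le_max_left s b).trans (hτmem n).1.le, (le_max_right s b).trans (hτmem n).1.le,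
    (hτmem n).2, 1 / ((n : ℝ) + 1), by positivity, (measure_mono fun ω hω => ?_).trans hn⟩
  exact mem_iInter₂.2 fun u hu => hω u ⟨hu.2.1.le, hu.2.2.le⟩

theorem exists_times_ae_exit [IsFiniteMeasure P] (hXm : ∀ t, Measurable (X t))
    (hcont : ∀ᵐ ω ∂P, Continuous fun t => X t ω)
    (hvary : ∀ᵐ ω ∂P, ¬ EventuallyConst (fun t => X t ω) (𝓝[<] 1)) :
    ∃ (τ : ℕ → I) (ε : ℕ → ℝ), Monotone τ ∧ τ 0 = 0 ∧ (∀ n, τ n < 1) ∧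
      Tendsto τ atTop (𝓝 1) ∧ (∀ n, 0 < ε n) ∧
      ∀ᵐ ω ∂P, ∀ᶠ n in atTop, ∃ u ∈ Icc (τ n) (τ (n + 1)), 2 * ε n < |X u ω - X (τ n) ω| := by
  obtain ⟨b, -, hbmem, hblim⟩ := exists_seq_strictMono_tendsto' (zero_lt_one (α := I))
  obtain ⟨p, hp, hpsum⟩ := ENNReal.exists_pos_sum_of_countable' one_ne_zero ℕ
  have hstep (n : ℕ) (s : Iio (1 : I)) : ∃ t : Iio (1 : I), s ≤ t ∧ b n ≤ t ∧ ∃ ε > 0,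
      P {ω | ∀ u ∈ Icc s.1 t, |X u ω - X s ω| ≤ 2 * ε} ≤ p n :=
    let ⟨t, hst, hbt, ht, hball⟩ :=
      exists_measure_forall_abs_sub_le hXm hcont hvary s.2 (hbmem n).2 (hp n)
    ⟨⟨t, ht⟩, hst, hbt, hball⟩
  choose succTime hle hb rad hrad hprob using hstep
  let τ : ℕ → Iio (1 : I) := Nat.rec ⟨0, zero_lt_one' I⟩ succTime
  have hτb (n : ℕ) : b n ≤ τ (n + 1) := hb n (τ n)
  have hτlim : Tendsto (fun n => (τ n).1) atTop (𝓝 1) := by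
    refine (tendsto_add_atTop_iff_nat 1).1 ?_
    exact tendsto_of_tendsto_of_tendsto_of_le_of_le hblim tendsto_const_nhds hτb
      fun n => (mem_Iio.1 (τ (n + 1)).2).le
  refine ⟨fun n => (τ n).1, fun n => rad n (τ n), monotone_nat_of_le_succ fun n => hle n (τ n), rfl,
    fun n => (τ n).2, hτlim, fun n => hrad n (τ n), ?_⟩
  have hsum := ENNReal.tsum_le_tsum fun n => hprob n (τ n)
  filter_upwards [ae_eventually_notMem (ne_top_of_lt (hsum.trans_lt hpsum))] with ω hω
  filter_upwards [hω] with n hn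
  simpa only [mem_ofPred_eq, not_forall, not_le, exists_prop] using hn

theorem TradingSchedule.exists_isFine_ae_exits [IsFiniteMeasure P] {r : ℝ} (hr : 1 / 2 < r)
    (hXm : ∀ t, Measurable (X t)) (hcont : ∀ᵐ ω ∂P, Continuous fun t => X t ω)
    (hvary : ∀ᵐ ω ∂P, ¬ EventuallyConst (fun t => X t ω) (𝓝[<] 1)) :
    ∃ S : TradingSchedule, S.IsFine r ∧
      ∀ᵐ ω ∂P, ∀ᶠ n in atTop, S.Exits (processPath X ω) n := by
  obtain ⟨τ, ε, hmono, hzero, hlt, hlim, hε, hexit⟩ := exists_times_ae_exit hXm hcont hvary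
  choose N hN hfine using fun n : ℕ =>
    exists_fine_grid n hr (sub_nonneg.2 (Subtype.coe_le_coe.2 (hmono n.le_succ))) (hε n)
  refine ⟨⟨τ, hmono, hzero, hlt, hlim, N, hN, ε, hε⟩, hfine, ?_⟩
  filter_upwards [hexit] with ω hω
  filter_upwards [hω] with n ⟨u, hu, hfar⟩
  exact ⟨u, hu, by simpa only [processPath_coe] using hfar⟩

end Exit

section SmallBall

variable {Ω : Type*} [MeasurableSpace Ω] {P : Measure Ω} {X : I → Ω → ℝ} {α : ℝ}

theorem tendsto_exp_neg_mul_rpow_neg {c p : ℝ} (hc : 0 < c) (hp : 0 < p) :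
    Tendsto (fun ε : ℝ => Real.exp (-(c * ε ^ (-p)))) (𝓝[>] 0) (𝓝 0) :=
  Real.tendsto_exp_neg_atTop_nhds_zero.comp
    ((tendsto_rpow_neg_nhdsGT_zero (neg_lt_zero.2 hp)).const_mul_atTop hc)

theorem SmallBall.exists_measure_forall_eq_eq_zero (h : SmallBall P X α) (hα : 0 < α) :
    ∃ δ > (0 : ℝ), ∀ s t : I, 1 - δ ≤ (s : ℝ) → s < t →
      P {ω | ∀ u ∈ Icc s t, X u ω = X s ω} = 0 := by
  obtain ⟨δ, hδ, C, hC, hball⟩ := h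
  refine ⟨δ, hδ, fun s t hs hst => ?_⟩
  have hlen : 0 < (t : ℝ) - s := sub_pos.2 hst
  have hlim := ENNReal.tendsto_ofReal
    (tendsto_exp_neg_mul_rpow_neg (mul_pos hC hlen) (one_div_pos.2 hα))
  rw [ENNReal.ofReal_zero] at hlim
  refine le_antisymm (ge_of_tendsto hlim ?_) zero_le
  filter_upwards [Ioc_mem_nhdsGT (Real.rpow_pos_of_pos hlen α)] with ε hε
  refine (measure_mono fun ω hω u hu => ?_).trans (hball s t hs hst.le ε hε.1 hε.2)
  rw [hω u hu, sub_self, abs_zero]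
  exact hε.1.le

theorem SmallBall.ae_not_eventuallyConst (h : SmallBall P X α) (hα : 0 < α) :
    ∀ᵐ ω ∂P, ¬ EventuallyConst (fun t => X t ω) (𝓝[<] 1) := by
  obtain ⟨δ, hδ, hnull⟩ := h.exists_measure_forall_eq_eq_zero hα
  obtain ⟨τ, hτmono, hτmem, hτlim⟩ := exists_seq_strictMono_tendsto' (zero_lt_one (α := I))
  have hτlim' : Tendsto (fun n => (τ n : ℝ)) atTop (𝓝 1) :=
    (continuous_subtype_val.tendsto _).comp hτlim
  have hae : ∀ᵐ ω ∂P, ∀ n, 1 - δ ≤ (τ n : ℝ) → ¬ ∀ u ∈ Icc (τ n) (τ (n + 1)), X u ω = X (τ n) ω :=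
    ae_all_iff.2 fun n => by
      by_cases hn : 1 - δ ≤ (τ n : ℝ)
      · filter_upwards [measure_eq_zero_iff_ae_notMem.1
          (hnull _ _ hn (hτmono n.lt_succ_self))] with ω hω _ using hω
      · exact .of_forall fun _ h => absurd h hn
  filter_upwards [hae] with ω hω hconst
  obtain ⟨c, hc⟩ := eventuallyConst_iff_exists_eventuallyEq.1 hconst
  obtain ⟨s, hs, hsc⟩ := (mem_nhdsLT_iff_exists_Ioo_subset' (zero_lt_one (α := I))).1 hc
  obtain ⟨n, hsn, hδn⟩ := ((hτlim.eventually_const_lt hs).and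
    (hτlim'.eventually_const_le (show 1 - δ < 1 by linarith))).exists
  refine hω n hδn fun u hu => ?_
  exact (hsc ⟨hsn.trans_le hu.1, hu.2.trans_lt (hτmem _).2⟩ : X u ω = c).trans
    (hsc ⟨hsn, (hτmem n).2⟩ : X (τ n) ω = c).symm

end SmallBall

section Replication

variable {Ω : Type*} {m : MeasurableSpace Ω} {P : Measure Ω} {X : I → Ω → ℝ} {a : ℝ}

theorem HasHolderPaths.ae_holderWith (h : HasHolderPaths P X a) (ha : 0 ≤ a) :
    ∀ᵐ ω ∂P, ∃ C : ℝ≥0, HolderWith C a.toNNReal (processPath X ω) :=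
  h.mono fun _ ⟨_, hC⟩ => ⟨_, holderWith_processPath ha hC⟩

theorem HasHolderPaths.ae_continuous (h : HasHolderPaths P X a) (ha : 0 < a) :
    ∀ᵐ ω ∂P, Continuous fun t => X t ω := by
  filter_upwards [h.ae_holderWith ha.le] with ω ⟨C, hC⟩
  exact ((hC.continuous (Real.toNNReal_pos.2 ha)).comp continuous_subtype_val).congr
    (processPath_coe X ω)

theorem processPath_integrand_eqOn (S : TradingSchedule) (η : ℕ → Ω → ℝ) (ω : Ω) :
    EqOn (processPath (fun t ω => S.integrand (fun n => η n ω) (processPath X ω) t) ω)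
      (S.integrand (fun n => η n ω) (processPath X ω)) (Icc 0 1) :=
  fun _ hu => IccExtend_of_mem zero_le_one _ hu

theorem mainTheorem3_general [IsFiniteMeasure P] {𝓕 : Filtration I m}
    (hF : LeftContinuousAtOne 𝓕) (hX : Adapted 𝓕 X) (ha : 1 / 2 < a)
    (hHolder : HasHolderPaths P X a)
    (hvary : ∀ᵐ ω ∂P, ¬ EventuallyConst (fun t => X t ω) (𝓝[<] 1))
    {ξ : Ω → ℝ} (hξ : Measurable[𝓕 1] ξ) :
    ∃ ψ : I → Ω → ℝ, Adapted 𝓕 ψ ∧ ∀ᵐ ω ∂P, ∀ β ∈ Ioo (0 : ℝ) 1, 1 - a < β →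
      (∀ t ∈ Ico (0 : ℝ) 1, GLSIntegrable β 0 t (processPath ψ ω) (processPath X ω)) ∧
      Tendsto (fun t : ℝ => glsIntegral β 0 t (processPath ψ ω) (processPath X ω))
        (𝓝[<] 1) (𝓝 (ξ ω)) := by
  have ha₀ : 0 < a := by linarith
  obtain ⟨S, hfine, hexit⟩ := TradingSchedule.exists_isFine_ae_exits ha
    (fun t => (hX t).mono (𝓕.le t) le_rfl) (hHolder.ae_continuous ha₀) hvary
  obtain ⟨η, hη, hηξ⟩ := exists_measurable_time_tendsto P hF S hξ
  refine ⟨_, S.adapted_integrand hX hη, ?_⟩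
  filter_upwards [hHolder.ae_holderWith ha₀.le, hexit, hηξ] with ω ⟨C, hC⟩ hexit hηξ β hβ hβa
  have hr : 1 - β < a.toNNReal := by
    rw [Real.coe_toNNReal a ha₀.le]
    linarith
  have heq := processPath_integrand_eqOn (X := X) S η ω
  constructor
  · intro t ht
    exact (TradingSchedule.glsIntegrable_integrand hβ hC hr ht.2).congr
      fun u hu => (heq ⟨hu.1.le, (hu.2.trans ht.2).le⟩).symm
  · rw [← Real.coe_toNNReal a ha₀.le] at hfine
    refine (TradingSchedule.tendsto_glsIntegral_integrand hβ hC hr hfine hexit hηξ).congr' ?_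
    filter_upwards [Ioo_mem_nhdsLT zero_lt_one] with t ht
    exact glsIntegral_congr ht.1.le fun u hu => (heq ⟨hu.1.le, (hu.2.trans ht.2).le⟩).symm

end Replication

theorem mainTheorem3 {Ω : Type*} {m : MeasurableSpace Ω} (P : Measure Ω) [IsProbabilityMeasure P]
    (𝓕 : Filtration I m) (hF : LeftContinuousAtOne 𝓕)
    (X : I → Ω → ℝ) (hX : Adapted 𝓕 X)
    (a α : ℝ) (ha : 1 / 2 < a) (haα : a ≤ α)
    (hHolder : HasHolderPaths P X a) (hBall : SmallBall P X α)
    (ξ : Ω → ℝ) (hξ : Measurable[𝓕 1] ξ) :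
    ∃ β : ℝ, 1 - a < β ∧ β < 1 ∧
      ∃ ψ : I → Ω → ℝ, Adapted 𝓕 ψ ∧
        ∀ᵐ ω ∂P,
          (∀ t ∈ Ico (0 : ℝ) 1, GLSIntegrable β 0 t (processPath ψ ω) (processPath X ω)) ∧
          Tendsto (fun t : ℝ => glsIntegral β 0 t (processPath ψ ω) (processPath X ω))
            (𝓝[<] 1) (𝓝 (ξ ω)) := by
  obtain ⟨ψ, hψ, hint⟩ := mainTheorem3_general hF hX ha hHolder
    (hBall.ae_not_eventuallyConst (by linarith)) hξ
  exact ⟨1 / 2, by linarith, by norm_num, ψ, hψ, hint.mono fun _ h =>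
    h (1 / 2) (by norm_num) (by linarith)⟩
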